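/- **Setting.** Let $\mathbf U=\mathbf U_1\times\dots\times\mathbf U_N\subset\mathbb R^{n_1}\times\dots\times\mathbb R^{n_N}=\mathbb R^n$ be closed and convex, let $\mathbf C\subset\mathbb R^m$ be a nonempty closed convex cone with vertex at the origin, $\mathbf C^*=\{y:\langle y,x\rangle\ge 0\ \forall x\in\mathbf C\}$, and let $\Pi$ be the Euclidean projection onto $\mathbf C^*$. Consider $$\text{(P)}\qquad \min\ G(u)+J(u)\quad\text{s.t.}\quad \Theta(u)=\Omega(u)+\Phi(u)\in-\mathbf C,\ u\in\mathbf U,$$ with $J(u)=\sum_{i=1}^N J_i(u_i)$, $J_i:\mathbb R^{n_i}\to(-\infty,+\infty]$, and $\Phi(u)=\sum_{i=1}^N\Phi_i(u_i)$. Its Lagrangian is $L(u,p)=G(u)+J(u)+\langle p,\Theta(u)\rangle$; a saddle point is a pair $(u^*,p^*)\in\mathbf U\times\mathbf C^*$ with $L(u^*,p)\le L(u^*,p^*)\le L(u,p^*)$ for all $u\in\mathbf U$, $p\in\mathbf C^*$. A dual optimal solution is a maximizer over $\mathbf C^*$ of $p\mapsto\inf_{u\in\mathbf U}L(u,p)$.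 **Assumption 1.** (i) $J$ is convex and l.s.c., $\mathbf{dom}\,J\cap\mathbf U\ne\emptyset$, $\partial J(u)\neq\emptyset$ for $u\in\mathbf U$, and there are $c_1,c_2>0$ with $\|r\|\le c_1\|u\|+c_2$ for all $u\in\mathbf U$, $r\in\partial J(u)$. (ii) $G$ is convex on $\mathbf U$ and differentiable at the points of $\mathbf U$, and $\nabla G$ is Lipschitz on $\mathbf U$ with constant $B_G\ge0$. (iii) $\Omega:\mathbb R^n\to\mathbb R^m$ is $\mathbf C$-convex on $\mathbf U$, i.e. $\Omega(\alpha u+(1-\alpha)v)-\alpha\Omega(u)-(1-\alpha)\Omega(v)\in-\mathbf C$ for $u,v\in\mathbf U$, $\alpha\in[0,1]$; it is differentiable at the points of $\mathbf U$, and $T\in\mathbf C$ is such that $\langle\nabla\Omega(u)-\nabla\Omega(v),u-v\rangle-\|u-v\|^2T\in-\mathbf C$ for $u,v\in\mathbf U$. (iv) $\Phi:\mathbb R^n\to\mathbb R^m$ is $\mathbf C$-convex on $\mathbf U$. (v) $\Theta$ is Lipschitz with constant $\tau\ge0$ on an open set containing $\mathbf U$. (vi) If $\mathring{\mathbf C}\ne\emptyset$,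 then $\Theta(\mathbf U)\cap(-\mathring{\mathbf C})\neq\emptyset$; if $\mathbf C=\{0\}$, then $0$ is an interior point of $\Theta(\mathbf U)$. (vii) $L$ has at least one saddle point. **Assumption 2.** $K(u)=\sum_{i=1}^NK_i(u_i)$ is strongly convex on $\mathbf U$ with parameter $\beta>0$ and differentiable at the points of $\mathbf U$, with $\nabla K$ Lipschitz on $\mathbf U$ with constant $B$. Put $D(u,v)=K(u)-K(v)-\langle\nabla K(v),u-v\rangle$. **Method (SPDCL).** Let $\gamma>0$, $\rho=\frac{\gamma}{2N-1}$, $B_G+\gamma\tau^2>0$; let $\mu_0$ be a bound on the norms of all dual optimal solutions of (P), $\mu=\mu_0+1$, and let $\mathcal P_\mu$ be the projection onto $\{p:\|p\|\le\mu\}$. Start from $u^0\in\mathbf U$, $p^0\in\mathbb R^m$, $\epsilon^{-1}>0$ (here $\epsilon^{-1}$ is the entry of index $-1$ of the sequence $\epsilon^k$). For $k=0,1,\dots$ put $q^k=\Pi(p^k+\gamma\Theta(u^k))$ and $$\epsilon^k=\min\Big\{\epsilon^{k-1},\ \frac{\beta}{2(B_G+\|q^k\|\,\|T\|+\gamma\tau^2)}\Big\},$$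 choose $i(k)$ uniformly in $\{1,\dots,N\}$, independently of $i(0),\dots,i(k-1)$, and let $$u^{k+1}\in\arg\min_{u\in\mathbf U}\ \langle\nabla_{i(k)}G(u^k),u_{i(k)}\rangle+J_{i(k)}(u_{i(k)})+\langle q^k,\nabla_{i(k)}\Omega(u^k)u_{i(k)}+\Phi_{i(k)}(u_{i(k)})\rangle+\tfrac1{\epsilon^k}D(u,u^k),$$ $$p^{k+1}=\mathcal P_\mu\Big(p^k+\tfrac{\rho}{\gamma}\big(\Pi(p^k+\gamma\Theta(u^{k+1}))-p^k\big)\Big).$$ Write $\mathbb E_{i(k)}$ for the conditional expectation given $i(0),\dots,i(k-1)$. **Theorem 3 (Almost sure convergence).** Under Assumptions 1 and 2, for the iterates of SPDCL: (i) each $\|u^k-u^{k+1}\|^2$ is integrable, and $\sum_{k=0}^{\infty}\mathbb E_{i(k)}\frac\beta4\|u^k-u^{k+1}\|^2<+\infty$ a.s. and $\sum_{k=0}^{\infty}\frac{\epsilon^k}{2N\gamma}\|q^k-p^k\|^2<+\infty$ a.s.; (ii) the sequence $\{u^k\}$ is almost surely bounded; (iii) almost surely, every cluster point of $\{(u^k,p^k)\}$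 is a saddle point of $L$ on $\mathbf U\times\mathbf C^*$. -/

import Mathlib

open MeasureTheory ProbabilityTheory

noncomputable section

namespace SPDCL

/-- A nearest point of `S` to `x` (`x` itself if there is none). -/
def nearestPoint {F : Type*} [NormedAddCommGroup F] (S : Set F) (x : F) : F :=
  open Classical in
  if h : ∃ y ∈ S, ∀ z ∈ S, ‖x - y‖ ≤ ‖x - z‖ then h.choose else x

/-- On a nonempty closed subset of a finite-dimensional space, `nearestPoint S x` is indeed a point
of `S` nearest to `x` (the Euclidean projection, when `S` is convex). -/
theorem nearestPoint_spec {F : Type*} [NormedAddCommGroup F] [NormedSpace ℝ F]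
    [FiniteDimensional ℝ F] {S : Set F} (hS : IsClosed S) (hne : S.Nonempty) (x : F) :
    nearestPoint S x ∈ S ∧ ∀ z ∈ S, ‖x - nearestPoint S x‖ ≤ ‖x - z‖ := by
  classical
  have : ProperSpace F := FiniteDimensional.proper ℝ F
  have h : ∃ y ∈ S, ∀ z ∈ S, ‖x - y‖ ≤ ‖x - z‖ := by
    obtain ⟨y, hy, hxy⟩ := hS.exists_infDist_eq_dist hne x
    refine ⟨y, hy, fun z hz => ?_⟩
    rw [← dist_eq_norm, ← dist_eq_norm, ← hxy]
    exact Metric.infDist_le_dist_of_mem hz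
  unfold nearestPoint
  rw [dif_pos h]
  exact h.choose_spec

/-- The space `ℝ^{n_1} × ⋯ × ℝ^{n_N}` with its Euclidean norm. -/
abbrev Prim {N : ℕ} (d : Fin N → ℕ) : Type :=
  PiLp 2 (fun i : Fin N => EuclideanSpace ℝ (Fin (d i)))

/-- The space `ℝ^m` with its Euclidean norm. -/
abbrev Dual (m : ℕ) : Type := EuclideanSpace ℝ (Fin m)

/-- The data of a composite optimization problem with a composite cone constraint:
minimize `G u + J u` subject to `Om u + Phi u ∈ -C`, `u ∈ U`, where
`U = ∏ i, Ub i`, `J u = ∑ i, Jb i (u i)` and `Phi u = ∑ i, Phib i (u i)`. -/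
structure Problem {N : ℕ} (d : Fin N → ℕ) (m : ℕ) where
  Ub : ∀ i, Set (EuclideanSpace ℝ (Fin (d i)))
  G : Prim d → ℝ
  Jb : ∀ i, EuclideanSpace ℝ (Fin (d i)) → EReal
  Om : Prim d → Dual m
  Phib : ∀ i, EuclideanSpace ℝ (Fin (d i)) → Dual m
  C : ProperCone ℝ (Dual m)

/-- `f` is `C`-convex on `U`. -/
def ConeConvexOn {E F : Type*} [AddCommGroup E] [Module ℝ E] [NormedAddCommGroup F]
    [NormedSpace ℝ F] (C : ProperCone ℝ F) (U : Set E) (f : E → F) : Prop :=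
  ∀ u ∈ U, ∀ v ∈ U, ∀ α : ℝ, 0 ≤ α → α ≤ 1 →
    -(f (α • u + (1 - α) • v) - α • f u - (1 - α) • f v) ∈ C

/-- The subdifferential of an extended-valued function. -/
def subdiff {E : Type*} [NormedAddCommGroup E] [InnerProductSpace ℝ E] (f : E → EReal) (u : E) :
    Set E :=
  {r | ∀ v, f u + ((inner ℝ r (v - u) : ℝ) : EReal) ≤ f v}

namespace Problem

variable {N : ℕ} {d : Fin N → ℕ} {m : ℕ} (Q : Problem d m)

/-- The feasible box `U = U_1 × ⋯ × U_N`. -/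
def U : Set (Prim d) := {u | ∀ i, u i ∈ Q.Ub i}

/-- `J u = ∑ i, J_i (u_i)`. -/
def J (u : Prim d) : EReal := ∑ i, Q.Jb i (u i)

/-- `Φ u = ∑ i, Φ_i (u_i)`. -/
def Phi (u : Prim d) : Dual m := ∑ i, Q.Phib i (u i)

/-- `Θ = Ω + Φ`. -/
def Theta (u : Prim d) : Dual m := Q.Om u + Q.Phi u

/-- The conjugate cone `C* = {y | ⟪y, x⟫ ≥ 0 for all x ∈ C}`. -/
def Cstar : ProperCone ℝ (Dual m) := ProperCone.innerDual (Q.C : Set (Dual m))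

/-- The Lagrangian `L u p = G u + J u + ⟪p, Θ u⟫`. -/
def L (u : Prim d) (p : Dual m) : EReal :=
  Q.J u + ((Q.G u + inner ℝ p (Q.Theta u) : ℝ) : EReal)

/-- `(us, ps)` is a saddle point of the Lagrangian on `U × C*`. -/
def IsSaddle (us : Prim d) (ps : Dual m) : Prop :=
  us ∈ Q.U ∧ ps ∈ Q.Cstar ∧
    ∀ u ∈ Q.U, ∀ p ∈ Q.Cstar, Q.L us p ≤ Q.L us ps ∧ Q.L us ps ≤ Q.L u ps

/-- The dual function: `inf_{u ∈ U} L u p` on `C*`, and `-∞` elsewhere. -/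
def dualFun (p : Dual m) : EReal :=
  open Classical in if p ∈ Q.Cstar then ⨅ u ∈ Q.U, Q.L u p else ⊥

/-- `p` is a solution of the dual problem: it maximizes the dual function over `C*`. -/
def IsDualOptimal (p : Dual m) : Prop :=
  p ∈ Q.Cstar ∧ ∀ p' ∈ Q.Cstar, Q.dualFun p' ≤ Q.dualFun p

/-- The projection `Π` onto the conjugate cone. -/
def proj (x : Dual m) : Dual m := nearestPoint (Q.Cstar : Set (Dual m)) x

/-- The standing assumptions on the problem, with gradient Lipschitz constant `BG` of `G`,
curvature vector `T` of `Ω` and Lipschitz constant `τ` of `Θ`. -/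
structure Standing (BG : ℝ) (T : Dual m) (τ : ℝ) : Prop where
  closed_U : IsClosed Q.U
  convex_U : Convex ℝ Q.U
  J_ne_bot : ∀ i x, Q.Jb i x ≠ ⊥
  J_dom : ∃ u ∈ Q.U, Q.J u ≠ ⊤
  J_convex : Convex ℝ {z : Prim d × ℝ | Q.J z.1 ≤ (z.2 : EReal)}
  J_lsc : LowerSemicontinuous Q.J
  J_subdiff : ∀ u ∈ Q.U, (subdiff Q.J u).Nonempty
  J_linear_bound : ∃ c₁ > (0 : ℝ), ∃ c₂ > (0 : ℝ),
    ∀ u ∈ Q.U, ∀ r ∈ subdiff Q.J u, ‖r‖ ≤ c₁ * ‖u‖ + c₂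
  G_convex : ConvexOn ℝ Q.U Q.G
  G_diff : ∀ u ∈ Q.U, DifferentiableAt ℝ Q.G u
  BG_nonneg : 0 ≤ BG
  G_lip : ∀ u ∈ Q.U, ∀ v ∈ Q.U, ‖gradient Q.G u - gradient Q.G v‖ ≤ BG * ‖u - v‖
  Om_convex : ConeConvexOn Q.C Q.U Q.Om
  Om_diff : ∀ u ∈ Q.U, DifferentiableAt ℝ Q.Om u
  T_mem : T ∈ Q.C
  Om_curv : ∀ u ∈ Q.U, ∀ v ∈ Q.U,
    -((fderiv ℝ Q.Om u - fderiv ℝ Q.Om v) (u - v) - ‖u - v‖ ^ 2 • T) ∈ Q.C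
  Phi_convex : ConeConvexOn Q.C Q.U Q.Phi
  tau_nonneg : 0 ≤ τ
  Theta_lip : ∃ O : Set (Prim d), IsOpen O ∧ Q.U ⊆ O ∧
    ∀ u ∈ O, ∀ v ∈ O, ‖Q.Theta u - Q.Theta v‖ ≤ τ * ‖u - v‖
  cqc_interior : (interior (Q.C : Set (Dual m))).Nonempty →
    ∃ u ∈ Q.U, -Q.Theta u ∈ interior (Q.C : Set (Dual m))
  cqc_zero : (Q.C : Set (Dual m)) = {0} → 0 ∈ interior (Q.Theta '' Q.U)
  exists_saddle : ∃ us ps, Q.IsSaddle us ps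

end Problem

/-- The additive core function `K u = ∑ i, K_i (u_i)`. -/
def coreSum {N : ℕ} {d : Fin N → ℕ} (Kb : ∀ i, EuclideanSpace ℝ (Fin (d i)) → ℝ) (u : Prim d) : ℝ :=
  ∑ i, Kb i (u i)

/-- `K` is `β`-strongly convex and differentiable with `B`-Lipschitz gradient on `U`. -/
structure IsCore {E : Type*} [NormedAddCommGroup E] [InnerProductSpace ℝ E] [CompleteSpace E]
    (U : Set E) (K : E → ℝ) (β B : ℝ) : Prop where
  beta_pos : 0 < β
  strong : StrongConvexOn U β K
  diff : ∀ u ∈ U, DifferentiableAt ℝ K u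
  lip : ∀ u ∈ U, ∀ v ∈ U, ‖gradient K u - gradient K v‖ ≤ B * ‖u - v‖

/-- The Bregman-like function `D(u, v) = K u - K v - ⟪∇K v, u - v⟫`. -/
def bregman {E : Type*} [NormedAddCommGroup E] [InnerProductSpace ℝ E] [CompleteSpace E]
    (K : E → ℝ) (u v : E) : ℝ :=
  K u - K v - inner ℝ (gradient K v) (u - v)

namespace Problem

variable {N : ℕ} {d : Fin N → ℕ} {m : ℕ} (Q : Problem d m)

/-- `q = Π(p + γ Θ(u))`. -/
def q (γ : ℝ) (u : Prim d) (p : Dual m) : Dual m := Q.proj (p + γ • Q.Theta u)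

/-- The step size cap `β / (2 (B_G + ‖q‖ ‖T‖ + γ τ²))`. -/
def stepCap (BG τ β γ : ℝ) (T q : Dual m) : ℝ :=
  β / (2 * (BG + ‖q‖ * ‖T‖ + γ * τ ^ 2))

/-- The objective of the primal subproblem at `uk` for the selected block `i`. -/
def primalObj (K : Prim d → ℝ) (i : Fin N) (ε : ℝ) (uk : Prim d) (qk : Dual m) (u : Prim d) :
    EReal :=
  Q.Jb i (u i) +
    ((inner ℝ (gradient Q.G uk i) (u i)
      + inner ℝ qk (fderiv ℝ Q.Om uk (PiLp.single 2 i (u i)) + Q.Phib i (u i))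
      + 1 / ε * bregman K u uk : ℝ) : EReal)

/-- `(u, p, ε)` is the run of the method driven by the block indices `idx`, started at
`(u₀, p₀)` with initial step size `ε₀`, with parameters `γ`, `ρ` and dual radius `μ`. -/
structure IsRun (K : Prim d → ℝ) (BG τ β γ ρ μ : ℝ) (T : Dual m)
    (u₀ : Prim d) (p₀ : Dual m) (ε₀ : ℝ) (idx : ℕ → Fin N)
    (u : ℕ → Prim d) (p : ℕ → Dual m) (ε : ℕ → ℝ) : Prop where
  u_zero : u 0 = u₀
  p_zero : p 0 = p₀
  eps_zero : ε 0 = min ε₀ (stepCap BG τ β γ T (Q.q γ (u 0) (p 0)))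
  eps_succ : ∀ k, ε (k + 1) =
    min (ε k) (stepCap BG τ β γ T (Q.q γ (u (k + 1)) (p (k + 1))))
  u_mem : ∀ k, u (k + 1) ∈ Q.U
  u_min : ∀ k, IsMinOn (Q.primalObj K (idx k) (ε k) (u k) (Q.q γ (u k) (p k))) Q.U (u (k + 1))
  p_succ : ∀ k, p (k + 1) = nearestPoint (Metric.closedBall (0 : Dual m) μ)
    (p k + (ρ / γ) • (Q.q γ (u (k + 1)) (p k) - p k))

end Problem

/-- The σ-algebra generated by `i(0), …, i(k-1)`. -/
abbrev past {S : Type*} {N : ℕ} (idx : ℕ → S → Fin N) (k : ℕ) : MeasurableSpace S :=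
  ⨆ j : Fin k, MeasurableSpace.comap (idx j) inferInstance

end SPDCL

end

/-! The method is a stochastic block descent for the augmented Lagrangian `Laug`, whose multiplier
term `augTerm` is smooth and convex in `θ` with gradient `q = Π(p + γθ)`, and concave in `p` with
gradient `(q - p) / γ`. Progress is measured by `lyap`: the Bregman distance to a saddle point `(us,
ps)`, plus `ε` times a weighted sum of `‖ps - p‖ ^ 2` and the gap of `Laug` above the saddle value.
The weights keep this sum nonnegative (`lyap_coeff_nonneg`), so `lyap` controls `‖us - u‖ ^ 2` and
cannot grow when `ε` shrinks.

In one step, the prox inequality and the descent inequality for `augTerm` give `primal_step`;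
concavity in `p` gives `dual_step`, where the choice of `ρ` cancels all `‖q - p‖ ^ 2` terms.
Averaged over the blocks, the linearized differences add up to a full Lagrangian difference, and
convexity with the saddle inequality yields (`sum_lyap_step`) a mean decrease by the averaged `β / 4
* ‖u - x i‖ ^ 2` plus `ε / (2Nγ) * ‖q - p‖ ^ 2`.

Minimizers of the subproblem are unique, so the iterates are functions of finitely many block
choices. This settles measurability and integrability, and turns conditional expectations into
averages over the next choice (`condExp_past_eq`). Nonnegative supermartingale convergence
(`ae_bounded_and_summable`) then gives summability and boundedness.

Bounded iterates keep the steps away from zero. Hence, along a subsequence converging to a cluster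
point, `q - p` tends to `0` and all `N` candidate updates share the limit of `u`. The vector
assembled from the updated blocks is nearly optimal for the Lagrangian, and semicontinuity of `J`
gives the saddle inequalities (`isSaddle_of_tendsto`). -/

noncomputable section

namespace SPDCL

/-! ### Tangent and descent inequalities on a convex set. -/

section Calculus

variable {E : Type*} [NormedAddCommGroup E]

/-- A derivative at `0` is bounded by the slope of a quadratic upper bound to the right of `0`. -/
theorem deriv_le_of_quadratic_bound {ψ : ℝ → ℝ} {a c e : ℝ} (hψ : HasDerivAt ψ a 0)
    (h : ∀ s, 0 < s → s ≤ 1 → ψ s ≤ ψ 0 + s * c + s ^ 2 * e) : a ≤ c := by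
  have h1 := hψ.tendsto_slope_zero_right
  have h2 : Filter.Tendsto (fun s : ℝ => c + s * e) (nhdsWithin 0 (Set.Ioi 0)) (nhds (c + 0 * e)) :=
    Filter.Tendsto.mono_left (Continuous.tendsto (by fun_prop) 0) nhdsWithin_le_nhds
  rw [zero_mul, add_zero] at h2
  refine le_of_tendsto_of_tendsto h1 h2 ?_
  filter_upwards [Ioc_mem_nhdsGT (zero_lt_one' ℝ)] with s hs
  have := h s hs.1 hs.2
  rw [smul_eq_mul, zero_add, inv_mul_le_iff₀ hs.1]
  nlinarith

theorem hasDerivAt_comp_segment [NormedSpace ℝ E] {g : E → ℝ} {u d : E} {s : ℝ}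
    (h : DifferentiableAt ℝ g (u + s • d)) :
    HasDerivAt (fun s : ℝ => g (u + s • d)) (fderiv ℝ g (u + s • d) d) s := by
  have h1 : HasDerivAt (fun s : ℝ => u + s • d) d s := by
    simpa using ((hasDerivAt_id s).smul_const d).const_add u
  exact h.hasFDerivAt.comp_hasDerivAt s h1

theorem segment_mem [NormedSpace ℝ E] {U : Set E} (hU : Convex ℝ U) {u v : E} (hu : u ∈ U)
    (hv : v ∈ U) {s : ℝ} (h0 : 0 ≤ s) (h1 : s ≤ 1) : u + s • (v - u) ∈ U :=
  hU.add_smul_sub_mem hu hv ⟨h0, h1⟩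

/-- The descent lemma on a convex set. -/
theorem le_quadratic_of_fderiv_monotone [NormedSpace ℝ E] {U : Set E} (hU : Convex ℝ U)
    {g : E → ℝ} (hd : ∀ x ∈ U, DifferentiableAt ℝ g x) {M : ℝ}
    (hM : ∀ x ∈ U, ∀ y ∈ U, (fderiv ℝ g x - fderiv ℝ g y) (x - y) ≤ M * ‖x - y‖ ^ 2)
    {u v : E} (hu : u ∈ U) (hv : v ∈ U) :
    g v ≤ g u + fderiv ℝ g u (v - u) + M / 2 * ‖v - u‖ ^ 2 := by
  set d := v - u with hdd
  let ψ : ℝ → ℝ := fun s => g (u + s • d) - s * fderiv ℝ g u d - M / 2 * ‖d‖ ^ 2 * s ^ 2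
  have hder : ∀ s ∈ Set.Icc (0:ℝ) 1, HasDerivAt ψ
      (fderiv ℝ g (u + s • d) d - fderiv ℝ g u d - M / 2 * ‖d‖ ^ 2 * (2 * s)) s := by
    intro s hs
    have h1 := hasDerivAt_comp_segment (hd _ (segment_mem hU hu hv hs.1 hs.2))
    have h2 : HasDerivAt (fun s : ℝ => s * fderiv ℝ g u d) (fderiv ℝ g u d) s := by
      simpa using (hasDerivAt_id s).mul_const (fderiv ℝ g u d)
    have h3 : HasDerivAt (fun s : ℝ => M / 2 * ‖d‖ ^ 2 * s ^ 2) (M / 2 * ‖d‖ ^ 2 * (2 * s)) s := by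
      simpa using (hasDerivAt_pow 2 s).const_mul (M / 2 * ‖d‖ ^ 2)
    exact (h1.sub h2).sub h3
  have hanti : AntitoneOn ψ (Set.Icc 0 1) := by
    refine antitoneOn_of_deriv_nonpos (convex_Icc 0 1)
      (fun s hs => (hder s hs).continuousAt.continuousWithinAt) (fun s hs => ?_) (fun s hs => ?_)
    · rw [interior_Icc] at hs
      exact (hder s ⟨hs.1.le, hs.2.le⟩).differentiableAt.differentiableWithinAt
    · rw [interior_Icc] at hs
      rw [(hder s ⟨hs.1.le, hs.2.le⟩).deriv]
      have h := hM _ (segment_mem hU hu hv hs.1.le hs.2.le) u hu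
      rw [← hdd, add_sub_cancel_left, map_smul, norm_smul, Real.norm_of_nonneg hs.1.le,
        smul_eq_mul, sub_apply] at h
      have : s * (fderiv ℝ g (u + s • d) d - fderiv ℝ g u d) ≤ s * (M * ‖d‖ ^ 2 * s) := by
        nlinarith
      have := le_of_mul_le_mul_left this hs.1
      linarith
  have := hanti (Set.left_mem_Icc.2 zero_le_one) (Set.right_mem_Icc.2 zero_le_one) zero_le_one
  simp only [ψ, one_smul, zero_smul, add_zero, hdd, add_sub_cancel] at this
  linarith

/-- The tangent inequality for a strongly convex function (`β = 0` is plain convexity). -/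
theorem strong_tangent_le [NormedSpace ℝ E] {U : Set E} {g : E → ℝ} {β : ℝ}
    (hg : StrongConvexOn U β g) {u v : E}
    (hu : u ∈ U) (hv : v ∈ U) (hd : DifferentiableAt ℝ g u) :
    g u + fderiv ℝ g u (v - u) + β / 2 * ‖v - u‖ ^ 2 ≤ g v := by
  have h0 : DifferentiableAt ℝ g (u + (0:ℝ) • (v - u)) := by simpa using hd
  have h1 := hasDerivAt_comp_segment h0
  rw [zero_smul, add_zero] at h1
  have := deriv_le_of_quadratic_bound (c := g v - g u - β / 2 * ‖v - u‖ ^ 2)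
    (e := β / 2 * ‖v - u‖ ^ 2) h1 ?_
  · linarith
  intro s hs hs1
  have h := hg.2 hu hv (sub_nonneg.2 hs1) hs.le (by ring)
  have he : (1 - s) • u + s • v = u + s • (v - u) := by module
  rw [he, norm_sub_rev] at h
  simp only [smul_eq_mul, zero_smul, add_zero] at h ⊢
  nlinarith

theorem tangent_le [NormedSpace ℝ E] {U : Set E} {g : E → ℝ} (hg : ConvexOn ℝ U g) {u v : E}
    (hu : u ∈ U) (hv : v ∈ U) (hd : DifferentiableAt ℝ g u) :
    g u + fderiv ℝ g u (v - u) ≤ g v := by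
  simpa using strong_tangent_le (strongConvexOn_zero.2 hg) hu hv hd

end Calculus

/-! ### Bregman distances and the prox inequality. -/

section Bregman

variable {E : Type*} [NormedAddCommGroup E] [InnerProductSpace ℝ E] [CompleteSpace E]
  {U : Set E} {K : E → ℝ} {β B : ℝ}

theorem IsCore.bregman_lower (hK : IsCore U K β B) {u v : E} (hu : u ∈ U) (hv : v ∈ U) :
    β / 2 * ‖u - v‖ ^ 2 ≤ bregman K u v := by
  have := strong_tangent_le hK.strong hv hu (hK.diff v hv)
  unfold bregman
  rw [inner_gradient_left]
  linarith

theorem bregman_self (K : E → ℝ) (u : E) : bregman K u u = 0 := by simp [bregman]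

theorem bregman_three_point (K : E → ℝ) (x y z : E) :
    inner ℝ (gradient K x - gradient K z) (y - x) =
      bregman K y z - bregman K y x - bregman K x z := by
  unfold bregman
  simp only [inner_sub_left, inner_sub_right]
  ring

/-- The three-point inequality for a proximal step with a Bregman distance. -/
theorem IsCore.prox_inequality (hK : IsCore U K β B) {f : E → ℝ} (hf : ConvexOn ℝ U f) {c : ℝ}
    (x z : E) (hx : x ∈ U)
    (hmin : ∀ y ∈ U, f x + c * bregman K x z ≤ f y + c * bregman K y z) {y : E} (hy : y ∈ U) :
    f x + c * bregman K x z + c * bregman K y x ≤ f y + c * bregman K y z := by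
  have hd : DifferentiableAt ℝ K (x + (0:ℝ) • (y - x)) := by simpa using hK.diff x hx
  have h1 := hasDerivAt_comp_segment hd
  rw [zero_smul, add_zero] at h1
  -- `f` need not be differentiable: minimality along the segment and convexity bound the negated
  -- derivative of the Bregman term by the chord slope `f y - f x`.
  have h2 : HasDerivAt (fun s : ℝ => -(c * bregman K (x + s • (y - x)) z))
      (-(c * inner ℝ (gradient K x - gradient K z) (y - x))) 0 := by
    have h3 : HasDerivAt (fun s : ℝ => inner ℝ (gradient K z) (x + s • (y - x) - z))
        (inner ℝ (gradient K z) (y - x)) 0 := by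
      have : (fun s : ℝ => (inner ℝ (gradient K z) (x + s • (y - x) - z) : ℝ)) =
          fun s => inner ℝ (gradient K z) (x - z) + s * inner ℝ (gradient K z) (y - x) := by
        funext s
        simp only [inner_sub_right, inner_add_right, inner_smul_right]
        ring
      rw [this]
      simpa using ((hasDerivAt_id (0:ℝ)).mul_const
        (inner ℝ (gradient K z) (y - x) : ℝ)).const_add (inner ℝ (gradient K z) (x - z) : ℝ)
    rw [inner_sub_left, inner_gradient_left (f := K) (x := x)]
    exact ((h1.sub_const (K z)).sub h3 |>.const_mul c).neg
  have h4 := deriv_le_of_quadratic_bound (c := f y - f x) (e := 0) h2 ?_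
  · rw [bregman_three_point] at h4
    nlinarith
  intro s hs hs1
  have h5 := hmin _ (segment_mem hf.1 hx hy hs.le hs1)
  have h6 := hf.2 hx hy (sub_nonneg.2 hs1) hs.le (by ring)
  have he : (1 - s) • x + s • y = x + s • (y - x) := by module
  rw [he] at h6
  simp only [smul_eq_mul, zero_smul, add_zero] at h6 ⊢
  nlinarith

end Bregman

/-! ### Variational inequality for Euclidean projections. -/

section Projection

variable {F : Type*} [NormedAddCommGroup F] [InnerProductSpace ℝ F] [FiniteDimensional ℝ F]

theorem inner_sub_nearestPoint_le {S : Set F} (hS : IsClosed S) (hc : Convex ℝ S)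
    (hne : S.Nonempty) (x : F) {z : F} (hz : z ∈ S) :
    inner ℝ (x - nearestPoint S x) (z - nearestPoint S x) ≤ 0 := by
  obtain ⟨h1, h2⟩ := nearestPoint_spec hS hne x
  have : Nonempty S := hne.to_subtype
  refine (norm_eq_iInf_iff_real_inner_le_zero hc h1).1 (le_antisymm ?_ ?_) z hz
  · exact le_ciInf fun w => h2 w w.2
  · exact ciInf_le (f := fun w : S => ‖x - w‖) ⟨0, by rintro _ ⟨w, rfl⟩; positivity⟩ ⟨_, h1⟩

theorem norm_sub_nearestPoint_le {S : Set F} (hS : IsClosed S) (hc : Convex ℝ S)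
    (hne : S.Nonempty) (x : F) {z : F} (hz : z ∈ S) :
    ‖z - nearestPoint S x‖ ≤ ‖z - x‖ := by
  have h := inner_sub_nearestPoint_le hS hc hne x hz
  set y := nearestPoint S x
  have h2 : ‖z - x‖ ^ 2 = ‖z - y‖ ^ 2 - 2 * inner ℝ (x - y) (z - y) + ‖x - y‖ ^ 2 := by
    rw [show z - x = (z - y) - (x - y) by abel, norm_sub_sq_real, real_inner_comm]
  nlinarith [norm_nonneg (z - y), norm_nonneg (z - x), sq_nonneg ‖x - y‖]

theorem ball_projection_spec {μ : ℝ} (hμ : 0 ≤ μ) (x : F) :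
    ‖nearestPoint (Metric.closedBall (0 : F) μ) x‖ ≤ μ ∧
      ∀ z : F, ‖z‖ ≤ μ → ‖z - nearestPoint (Metric.closedBall (0 : F) μ) x‖ ≤ ‖z - x‖ := by
  have hne : (Metric.closedBall (0 : F) μ).Nonempty := ⟨0, by simpa using hμ⟩
  refine ⟨?_, fun z hz => norm_sub_nearestPoint_le Metric.isClosed_closedBall
    (convex_closedBall 0 μ) hne x (by simpa using hz)⟩
  simpa using (nearestPoint_spec Metric.isClosed_closedBall hne x).1

end Projection

/-! ### The multiplier term of the augmented Lagrangian and the dual step. -/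

section DualStep

variable {m : ℕ}

/-- The value `(‖Π(p + γ θ)‖² - ‖p‖²) / (2γ)` of the multiplier term of the augmented Lagrangian,
where `Π` is the projection onto the cone `D`. -/
def augTerm (D : ProperCone ℝ (Dual m)) (γ : ℝ) (θ p : Dual m) : ℝ :=
  (‖nearestPoint (D : Set (Dual m)) (p + γ • θ)‖ ^ 2 - ‖p‖ ^ 2) / (2 * γ)

variable (D : ProperCone ℝ (Dual m)) {γ : ℝ}

theorem cone_projection_mem (x : Dual m) : nearestPoint (D : Set (Dual m)) x ∈ D :=
  (nearestPoint_spec D.isClosed ⟨0, D.zero_mem⟩ x).1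

theorem cone_projection_inner_le (x : Dual m) {r : Dual m} (hr : r ∈ D) :
    inner ℝ (x - nearestPoint (D : Set (Dual m)) x) (r - nearestPoint (D : Set (Dual m)) x) ≤ 0 :=
  inner_sub_nearestPoint_le D.isClosed D.convex ⟨0, D.zero_mem⟩ x hr

/-- The variational inequality is tested at `0` and at twice the projection, which gives both signs.
-/
theorem cone_projection_inner_self (x : Dual m) :
    inner ℝ (x - nearestPoint (D : Set (Dual m)) x) (nearestPoint (D : Set (Dual m)) x) = 0 := by
  have h1 := cone_projection_inner_le D x D.zero_mem
  have h2 := cone_projection_inner_le D x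
    (D.add_mem (cone_projection_mem D x) (cone_projection_mem D x))
  rw [zero_sub, inner_neg_right] at h1
  rw [add_sub_cancel_right] at h2
  linarith

/-- The surplus over `augTerm` is the source of the summable residual `‖q - p‖ ^ 2`. -/
theorem inner_projection_eq_augTerm (hγ : 0 < γ) (θ p : Dual m) :
    inner ℝ (nearestPoint (D : Set (Dual m)) (p + γ • θ)) θ =
      augTerm D γ θ p + ‖nearestPoint (D : Set (Dual m)) (p + γ • θ) - p‖ ^ 2 / (2 * γ) := by
  have h := cone_projection_inner_self D (p + γ • θ)
  unfold augTerm
  set q := nearestPoint (D : Set (Dual m)) (p + γ • θ)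
  rw [inner_sub_left, inner_add_left, inner_smul_left, real_inner_self_eq_norm_sq,
    real_inner_comm, real_inner_comm q θ] at h
  rw [norm_sub_sq_real]
  simp only [conj_trivial] at h
  field_simp
  linarith

/-- `augTerm` is the maximum of a strongly concave function, attained at the projection. -/
theorem le_augTerm (hγ : 0 < γ) (θ p : Dual m) {r : Dual m} (hr : r ∈ D) :
    inner ℝ r θ - ‖r - p‖ ^ 2 / (2 * γ) +
      ‖r - nearestPoint (D : Set (Dual m)) (p + γ • θ)‖ ^ 2 / (2 * γ) ≤ augTerm D γ θ p := by
  have h := cone_projection_inner_self D (p + γ • θ)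
  have h2 := cone_projection_inner_le D (p + γ • θ) hr
  unfold augTerm
  set q := nearestPoint (D : Set (Dual m)) (p + γ • θ)
  rw [inner_sub_right, h, sub_zero, inner_sub_left, inner_add_left, inner_smul_left,
    real_inner_comm, real_inner_comm r θ, real_inner_comm r q] at h2
  rw [norm_sub_sq_real, norm_sub_sq_real, ← sub_nonneg]
  simp only [conj_trivial] at h2
  have : (‖q‖ ^ 2 - ‖p‖ ^ 2) / (2 * γ) - (inner ℝ r θ -
      (‖r‖ ^ 2 - 2 * inner ℝ r p + ‖p‖ ^ 2) / (2 * γ) +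
      (‖r‖ ^ 2 - 2 * inner ℝ r q + ‖q‖ ^ 2) / (2 * γ)) =
      (inner ℝ r q - inner ℝ r p - γ * inner ℝ r θ) / γ := by
    field_simp
    ring
  rw [this]
  exact div_nonneg (by linarith) hγ.le

theorem augTerm_eq (hγ : 0 < γ) (θ p : Dual m) :
    augTerm D γ θ p = inner ℝ (nearestPoint (D : Set (Dual m)) (p + γ • θ)) θ -
      ‖nearestPoint (D : Set (Dual m)) (p + γ • θ) - p‖ ^ 2 / (2 * γ) := by
  rw [inner_projection_eq_augTerm D hγ]; ring

/-- This is the descent inequality in `θ`. The spare square `‖q' - q‖ ^ 2 / (2γ)` in `le_augTerm`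
pays, by Young's inequality, for replacing `q'` by `q` in the inner product with `θ' - θ`. -/
theorem augTerm_smooth (hγ : 0 < γ) (θ θ' p : Dual m) :
    inner ℝ (nearestPoint (D : Set (Dual m)) (p + γ • θ)) (θ - θ') ≤
      augTerm D γ θ p - augTerm D γ θ' p + γ / 2 * ‖θ' - θ‖ ^ 2 := by
  have h1 := le_augTerm D hγ θ p (cone_projection_mem D (p + γ • θ'))
  rw [augTerm_eq D hγ θ' p]
  set q := nearestPoint (D : Set (Dual m)) (p + γ • θ)
  set q' := nearestPoint (D : Set (Dual m)) (p + γ • θ')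
  have h2 : 0 ≤ ‖(q' - q) - γ • (θ' - θ)‖ ^ 2 / (2 * γ) := by positivity
  rw [norm_sub_sq_real, inner_smul_right, norm_smul, Real.norm_of_nonneg hγ.le] at h2
  have h3 : (‖q' - q‖ ^ 2 - 2 * (γ * inner ℝ (q' - q) (θ' - θ)) + (γ * ‖θ' - θ‖) ^ 2) / (2 * γ) =
      ‖q' - q‖ ^ 2 / (2 * γ) - inner ℝ (q' - q) (θ' - θ) + γ / 2 * ‖θ' - θ‖ ^ 2 := by
    field_simp
  rw [h3] at h2
  simp only [inner_sub_left, inner_sub_right] at h2 ⊢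
  linarith

/-- The supergradient at `p` is `(q - p) / γ`, so before truncation the dual update is an ascent
step of length `ρ`. -/
theorem augTerm_concave_le (hγ : 0 < γ) (θ p p' : Dual m) :
    augTerm D γ θ p' ≤ augTerm D γ θ p +
      inner ℝ (nearestPoint (D : Set (Dual m)) (p + γ • θ) - p) (p' - p) / γ := by
  have h1 := le_augTerm D hγ θ p (cone_projection_mem D (p' + γ • θ))
  rw [augTerm_eq D hγ θ p']
  set q := nearestPoint (D : Set (Dual m)) (p + γ • θ)
  set r := nearestPoint (D : Set (Dual m)) (p' + γ • θ)
  have h2 : 0 ≤ ‖(r - q) - (p' - p)‖ ^ 2 / (2 * γ) := by positivity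
  have h3 : ‖r - p‖ ^ 2 / (2 * γ) - ‖r - p'‖ ^ 2 / (2 * γ) - ‖r - q‖ ^ 2 / (2 * γ) +
      ‖(r - q) - (p' - p)‖ ^ 2 / (2 * γ) = inner ℝ (q - p) (p' - p) / γ := by
    rw [← sub_div, ← sub_div, ← add_div, div_eq_div_iff (by positivity) hγ.ne']
    simp only [← real_inner_self_eq_norm_sq, inner_sub_left, inner_sub_right]
    rw [real_inner_comm r p, real_inner_comm r p', real_inner_comm r q, real_inner_comm q p,
      real_inner_comm q p', real_inner_comm p p']
    ring
  linarith

/-- Converts the inner product that appears on expanding `‖r - p'‖ ^ 2` into the gap between the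
linear term at `r` and `augTerm`. -/
theorem inner_projection_sub_ge (hγ : 0 < γ) (θ p : Dual m) {r : Dual m} (hr : r ∈ D) :
    inner ℝ r θ - augTerm D γ θ p +
      ‖nearestPoint (D : Set (Dual m)) (p + γ • θ) - p‖ ^ 2 / (2 * γ) ≤
      inner ℝ (nearestPoint (D : Set (Dual m)) (p + γ • θ) - p) (r - p) / γ := by
  have h1 := le_augTerm D hγ θ p hr
  set q := nearestPoint (D : Set (Dual m)) (p + γ • θ)
  have h3 : ‖r - p‖ ^ 2 / (2 * γ) - ‖r - q‖ ^ 2 / (2 * γ) + ‖q - p‖ ^ 2 / (2 * γ) =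
      inner ℝ (q - p) (r - p) / γ := by
    rw [← sub_div, ← add_div, div_eq_div_iff (by positivity) hγ.ne']
    simp only [← real_inner_self_eq_norm_sq, inner_sub_left, inner_sub_right]
    rw [real_inner_comm r p, real_inner_comm r q, real_inner_comm q p]
    ring
  linarith

/-- One step of the dual iteration. -/
theorem dual_step (hγ : 0 < γ) {n ρ μ : ℝ} (hn : 1 ≤ n) (hρ : ρ = γ / (2 * n - 1))
    (θ p : Dual m) {r : Dual m} (hr : r ∈ D) (hrμ : ‖r‖ ≤ μ) (hpμ : ‖p‖ ≤ μ) :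
    (2 * n - 1) / (2 * n * γ) * ‖r - nearestPoint (Metric.closedBall (0 : Dual m) μ)
        (p + (ρ / γ) • (nearestPoint (D : Set (Dual m)) (p + γ • θ) - p))‖ ^ 2 +
      (1 - 1 / n) * augTerm D γ θ (nearestPoint (Metric.closedBall (0 : Dual m) μ)
        (p + (ρ / γ) • (nearestPoint (D : Set (Dual m)) (p + γ • θ) - p))) +
      1 / n * inner ℝ r θ ≤
    (2 * n - 1) / (2 * n * γ) * ‖r - p‖ ^ 2 + augTerm D γ θ p := by
  have hμ : 0 ≤ μ := (norm_nonneg _).trans hpμ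
  have ht : ρ / γ = 1 / (2 * n - 1) := by rw [hρ]; field_simp
  have h2n : 0 < 2 * n - 1 := by linarith
  have hn0 : 0 < n := by linarith
  rw [ht]
  set t := 1 / (2 * n - 1) with htdef
  have ht0 : 0 < t := by positivity
  have h1 := inner_projection_sub_ge D hγ θ p hr
  set q := nearestPoint (D : Set (Dual m)) (p + γ • θ) with hq
  obtain ⟨-, hb⟩ := ball_projection_spec hμ (p + t • (q - p))
  set p' := nearestPoint (Metric.closedBall (0 : Dual m) μ) (p + t • (q - p))
  have h2 := augTerm_concave_le D hγ θ p p'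
  rw [← hq] at h2
  -- Since `p` lies in the ball, projecting onto the ball brings the trial point no farther from
  -- `p`.
  have h3 : ‖p' - p‖ ≤ t * ‖q - p‖ := by
    have := hb p hpμ
    rw [sub_add_cancel_left, norm_neg, norm_smul, Real.norm_of_nonneg ht0.le] at this
    rwa [norm_sub_rev]
  have h4 : inner ℝ (q - p) (p' - p) / γ ≤ t * ‖q - p‖ ^ 2 / γ := by
    gcongr
    refine (real_inner_le_norm _ _).trans ?_
    nlinarith [norm_nonneg (q - p)]
  have h5 : ‖r - p'‖ ^ 2 ≤ ‖r - p‖ ^ 2 - 2 * t * inner ℝ (q - p) (r - p) + t ^ 2 * ‖q - p‖ ^ 2 := by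
    have := pow_le_pow_left₀ (norm_nonneg _) (hb r hrμ) 2
    rw [← sub_sub, norm_sub_sq_real (r - p), inner_smul_right, norm_smul, Real.norm_of_nonneg ht0.le,
      real_inner_comm] at this
    linarith
  set I := (inner ℝ (q - p) (r - p) : ℝ)
  set X := ‖q - p‖ ^ 2 with hX
  have h6 : (2 * n - 1) / (2 * n * γ) * ‖r - p'‖ ^ 2 ≤
      (2 * n - 1) / (2 * n * γ) * (‖r - p‖ ^ 2 - 2 * t * I + t ^ 2 * X) := by
    gcongr
  have h7 : (2 * n - 1) / (2 * n * γ) * (‖r - p‖ ^ 2 - 2 * t * I + t ^ 2 * X) =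
      (2 * n - 1) / (2 * n * γ) * ‖r - p‖ ^ 2 - 1 / n * (I / γ) + t / n * (X / (2 * γ)) := by
    rw [htdef]; field_simp
  have h8 : 1 / n * (inner ℝ r θ - augTerm D γ θ p + X / (2 * γ)) ≤ 1 / n * (I / γ) := by
    gcongr
  have hn1 : 0 ≤ 1 - 1 / n := by
    rw [sub_nonneg, div_le_one hn0]; exact hn
  have h9 : (1 - 1 / n) * augTerm D γ θ p' ≤ (1 - 1 / n) * (augTerm D γ θ p + t * X / γ) := by
    gcongr
    linarith
  -- The error of the `augTerm` change and of the squared distance cancels the surplus exactly,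
  -- because `t * (2 * n - 1) = 1`; this explains the value of `ρ`.
  have h10 : (1 - 1 / n) * (t * X / γ) + t / n * (X / (2 * γ)) - 1 / n * (X / (2 * γ)) = 0 := by
    have htn : t * (2 * n - 1) - 1 = 0 := by rw [htdef]; field_simp; ring
    have : (1 - 1 / n) * (t * X / γ) + t / n * (X / (2 * γ)) - 1 / n * (X / (2 * γ)) =
        X / (2 * γ * n) * (t * (2 * n - 1) - 1) := by field_simp; ring
    rw [this, htn, mul_zero]
  linarith

end DualStep

/-! ### Changing one block of a vector. -/

section Blocks

variable {N : ℕ} {d : Fin N → ℕ}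

/-- Replace the `i`-th block of `u` by `x`. -/
def setBlock (u : Prim d) (i : Fin N) (x : EuclideanSpace ℝ (Fin (d i))) : Prim d :=
  WithLp.toLp 2 (Function.update (fun j => u j) i x)

theorem setBlock_same (u : Prim d) (i : Fin N) (x : EuclideanSpace ℝ (Fin (d i))) :
    setBlock u i x i = x := by simp [setBlock]

theorem setBlock_of_ne (u : Prim d) {i j : Fin N} (h : j ≠ i) (x : EuclideanSpace ℝ (Fin (d i))) :
    setBlock u i x j = u j := by simp [setBlock, h]

theorem setBlock_mem {m : ℕ} {Q : Problem d m} {u y : Prim d} (hu : u ∈ Q.U) (hy : y ∈ Q.U)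
    (i : Fin N) : setBlock u i (y i) ∈ Q.U := by
  intro j
  by_cases h : j = i
  · subst h; rw [setBlock_same]; exact hy j
  · rw [setBlock_of_ne u h]; exact hu j

theorem sum_single (y : Prim d) : ∑ i, PiLp.single 2 i (y i) = y := by
  ext j : 1
  rw [WithLp.ofLp_sum, Finset.sum_apply, Finset.sum_eq_single j]
  · simp
  · intro i _ h
    simp [h.symm]
  · simp

/-- The convexity defect of a separable function along a change of one block is that of the
corresponding summand. -/
theorem block_defect {F : Type*} [AddCommGroup F] [Module ℝ F]
    (f : ∀ i, EuclideanSpace ℝ (Fin (d i)) → F) (x y : Prim d) (i : Fin N) {a b : ℝ}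
    (hab : a + b = 1) :
    ∑ j, f j ((a • x + b • setBlock x i (y i)) j) - a • ∑ j, f j (x j) -
      b • ∑ j, f j (setBlock x i (y i) j) =
    f i ((a • x + b • y) i) - a • f i (x i) - b • f i (y i) := by
  rw [Finset.smul_sum, Finset.smul_sum, ← Finset.sum_sub_distrib, ← Finset.sum_sub_distrib,
    Finset.sum_eq_single i]
  · simp only [PiLp.add_apply, PiLp.smul_apply, setBlock_same]
  · intro j _ hj
    simp only [PiLp.add_apply, PiLp.smul_apply, setBlock_of_ne x hj]
    rw [← add_smul, hab, one_smul, sub_sub, ← add_smul, hab, one_smul, sub_self]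
  · simp

theorem ConeConvexOn.convexOn_inner {E F : Type*} [AddCommGroup E] [Module ℝ E]
    [NormedAddCommGroup F] [InnerProductSpace ℝ F] [CompleteSpace F] {C : ProperCone ℝ F} {U : Set E}
    {f : E → F} (hf : ConeConvexOn C U f) (hU : Convex ℝ U) {q : F}
    (hq : q ∈ ProperCone.innerDual (C : Set F)) : ConvexOn ℝ U fun x => (inner ℝ q (f x) : ℝ) := by
  refine ⟨hU, fun x hx y hy a b ha hb hab => ?_⟩
  have h := hf x hx y hy a ha (by linarith)
  have h2 := ProperCone.mem_innerDual.1 hq h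
  obtain rfl : b = 1 - a := by linarith
  rw [real_inner_comm, inner_neg_right, inner_sub_right, inner_sub_right, inner_smul_right,
    inner_smul_right] at h2
  simp only [smul_eq_mul]
  linarith

end Blocks

theorem ereal_sum_ne_bot {ι : Type*} (s : Finset ι) (f : ι → EReal) (h : ∀ i ∈ s, f i ≠ ⊥) :
    ∑ i ∈ s, f i ≠ ⊥ := by
  classical
  induction s using Finset.induction_on with
  | empty => simp
  | insert a s ha ih =>
    rw [Finset.sum_insert ha, EReal.add_ne_bot_iff]
    exact ⟨h a (by simp), ih fun i hi => h i (by simp [hi])⟩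

theorem ereal_coe_sum {ι : Type*} (s : Finset ι) (f : ι → ℝ) :
    ((∑ i ∈ s, f i : ℝ) : EReal) = ∑ i ∈ s, (f i : EReal) := by
  classical
  induction s using Finset.induction_on with
  | empty => simp
  | insert a s ha ih => rw [Finset.sum_insert ha, Finset.sum_insert ha, EReal.coe_add, ih]

/-! ### Real-valued and augmented Lagrangians and their linearization. -/

namespace Problem

variable {N : ℕ} {d : Fin N → ℕ} {m : ℕ} (Q : Problem d m)

/-- The real-valued version of `J`. -/
def Jreal (u : Prim d) : ℝ := ∑ i, (Q.Jb i (u i)).toReal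

/-- The real-valued version of the Lagrangian. -/
def Lreal (u : Prim d) (p : Dual m) : ℝ := Q.Jreal u + (Q.G u + inner ℝ p (Q.Theta u))

/-- The augmented Lagrangian. -/
def Laug (γ : ℝ) (u : Prim d) (p : Dual m) : ℝ :=
  Q.Jreal u + (Q.G u + augTerm Q.Cstar γ (Q.Theta u) p)

/-- The part of the primal subproblem at `u` for block `i` without the Bregman term. -/
def blockObj (u : Prim d) (q : Dual m) (i : Fin N) (y : Prim d) : ℝ :=
  (Q.Jb i (y i)).toReal + (inner ℝ (gradient Q.G u i) (y i)
    + inner ℝ q (fderiv ℝ Q.Om u (PiLp.single 2 i (y i)) + Q.Phib i (y i)))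

theorem q_mem (γ : ℝ) (u : Prim d) (p : Dual m) : Q.q γ u p ∈ Q.Cstar :=
  cone_projection_mem Q.Cstar _

theorem Lreal_q_eq {γ : ℝ} (hγ : 0 < γ) (u : Prim d) (p : Dual m) :
    Q.Lreal u (Q.q γ u p) = Q.Laug γ u p + ‖Q.q γ u p - p‖ ^ 2 / (2 * γ) := by
  have := inner_projection_eq_augTerm Q.Cstar hγ (Q.Theta u) p
  unfold Lreal Laug Problem.q proj
  rw [this]; ring

theorem Lreal_le_Laug {γ : ℝ} (hγ : 0 < γ) (u : Prim d) (p : Dual m) {r : Dual m}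
    (hr : r ∈ Q.Cstar) : Q.Lreal u r ≤ Q.Laug γ u p + ‖r - p‖ ^ 2 / (2 * γ) := by
  have := le_augTerm Q.Cstar hγ (Q.Theta u) p hr
  have h2 : 0 ≤ ‖r - nearestPoint (Q.Cstar : Set (Dual m)) (p + γ • Q.Theta u)‖ ^ 2 / (2 * γ) := by
    positivity
  unfold Lreal Laug
  linarith

theorem inner_nonneg_of_mem {Q : Problem d m} {q y : Dual m} (hq : q ∈ Q.Cstar) (hy : y ∈ Q.C) :
    0 ≤ (inner ℝ q y : ℝ) := by
  rw [real_inner_comm]; exact ProperCone.mem_innerDual.1 hq hy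

theorem sum_blockObj (u : Prim d) (q : Dual m) (y : Prim d) :
    ∑ i, Q.blockObj u q i y = Q.Jreal y + (inner ℝ (gradient Q.G u) y +
      inner ℝ q (fderiv ℝ Q.Om u y + Q.Phi y)) := by
  unfold blockObj Jreal Phi
  rw [Finset.sum_add_distrib, Finset.sum_add_distrib, ← inner_sum, Finset.sum_add_distrib,
    ← map_sum, sum_single, PiLp.inner_apply (gradient Q.G u) y]

variable {Q} {BG τ : ℝ} {T : Dual m}

namespace Standing

/-- A subgradient inequality tested at a point of finite value excludes `⊤`. Hence `J` is real on
`U` and the rest can be done with real numbers. -/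
theorem J_ne_top (hQ : Q.Standing BG T τ) {u : Prim d} (hu : u ∈ Q.U) : Q.J u ≠ ⊤ := by
  obtain ⟨r, hr⟩ := hQ.J_subdiff u hu
  obtain ⟨v, -, hv⟩ := hQ.J_dom
  intro h
  have := hr v
  rw [h, EReal.top_add_coe, top_le_iff] at this
  exact hv this

theorem Jb_eq (hQ : Q.Standing BG T τ) {u : Prim d} (hu : u ∈ Q.U) (i : Fin N) :
    Q.Jb i (u i) = ((Q.Jb i (u i)).toReal : EReal) := by
  refine (EReal.coe_toReal (fun h => hQ.J_ne_top hu ?_) (hQ.J_ne_bot i _)).symm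
  unfold J
  rw [← Finset.add_sum_erase _ _ (Finset.mem_univ i), h]
  exact EReal.top_add_of_ne_bot (ereal_sum_ne_bot _ _ fun j _ => hQ.J_ne_bot j _)

theorem J_eq (hQ : Q.Standing BG T τ) {u : Prim d} (hu : u ∈ Q.U) :
    Q.J u = (Q.Jreal u : EReal) := by
  unfold J Jreal
  rw [ereal_coe_sum]
  exact Finset.sum_congr rfl fun i _ => hQ.Jb_eq hu i

theorem L_eq (hQ : Q.Standing BG T τ) {u : Prim d} (hu : u ∈ Q.U) (p : Dual m) :
    Q.L u p = (Q.Lreal u p : EReal) := by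
  unfold L Lreal
  rw [hQ.J_eq hu, ← EReal.coe_add]

theorem primalObj_eq (hQ : Q.Standing BG T τ) (K : Prim d → ℝ) (i : Fin N) (ε : ℝ) (u : Prim d)
    (q : Dual m) {y : Prim d} (hy : y ∈ Q.U) :
    Q.primalObj K i ε u q y = ((Q.blockObj u q i y + 1 / ε * bregman K y u : ℝ) : EReal) := by
  unfold primalObj blockObj
  rw [hQ.Jb_eq hy i, EReal.toReal_coe, ← EReal.coe_add]
  congr 1
  ring

theorem isSaddle_iff (hQ : Q.Standing BG T τ) {us : Prim d} {ps : Dual m} :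
    Q.IsSaddle us ps ↔ us ∈ Q.U ∧ ps ∈ Q.Cstar ∧ (∀ p ∈ Q.Cstar, Q.Lreal us p ≤ Q.Lreal us ps) ∧
      ∀ u ∈ Q.U, Q.Lreal us ps ≤ Q.Lreal u ps := by
  constructor
  · rintro ⟨h1, h2, h3⟩
    refine ⟨h1, h2, fun p hp => ?_, fun u hu => ?_⟩
    · have := (h3 us h1 p hp).1
      rwa [hQ.L_eq h1, hQ.L_eq h1, EReal.coe_le_coe_iff] at this
    · have := (h3 u hu ps h2).2
      rwa [hQ.L_eq h1, hQ.L_eq hu, EReal.coe_le_coe_iff] at this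
  · rintro ⟨h1, h2, h3, h4⟩
    refine ⟨h1, h2, fun u hu p hp => ⟨?_, ?_⟩⟩
    · rw [hQ.L_eq h1, hQ.L_eq h1, EReal.coe_le_coe_iff]; exact h3 p hp
    · rw [hQ.L_eq h1, hQ.L_eq hu, EReal.coe_le_coe_iff]; exact h4 u hu

theorem Jreal_convexOn (hQ : Q.Standing BG T τ) : ConvexOn ℝ Q.U Q.Jreal := by
  refine ⟨hQ.convex_U, fun x hx y hy a b ha hb hab => ?_⟩
  have h := hQ.J_convex (x := (x, Q.Jreal x)) (hQ.J_eq hx).le (y := (y, Q.Jreal y))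
    (hQ.J_eq hy).le ha hb hab
  simp only [Set.mem_ofPred_eq, Prod.fst_add, Prod.smul_fst, Prod.snd_add, Prod.smul_snd] at h
  rwa [hQ.J_eq (hQ.convex_U hx hy ha hb hab), EReal.coe_le_coe_iff] at h

/-- Only the sum is assumed convex; freezing the other blocks makes its convexity defect that of the
one summand. -/
theorem Jb_convexOn (hQ : Q.Standing BG T τ) (i : Fin N) :
    ConvexOn ℝ Q.U fun y => (Q.Jb i (y i)).toReal := by
  refine ⟨hQ.convex_U, fun x hx y hy a b ha hb hab => ?_⟩
  have h := hQ.Jreal_convexOn.2 hx (setBlock_mem hx hy i) ha hb hab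
  have h2 := block_defect (fun j z => (Q.Jb j z).toReal) x y i hab
  unfold Jreal at h
  linarith

theorem Phib_convexOn (hQ : Q.Standing BG T τ) {q : Dual m} (hq : q ∈ Q.Cstar) (i : Fin N) :
    ConvexOn ℝ Q.U fun y => (inner ℝ q (Q.Phib i (y i)) : ℝ) := by
  refine ⟨hQ.convex_U, fun x hx y hy a b ha hb hab => ?_⟩
  have h := (hQ.Phi_convex.convexOn_inner hQ.convex_U hq).2 hx (setBlock_mem hx hy i) ha hb hab
  have h2 := block_defect (fun j z => (inner ℝ q (Q.Phib j z) : ℝ)) x y i hab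
  simp only [Phi, inner_sum] at h
  linarith

theorem blockObj_convexOn (hQ : Q.Standing BG T τ) (u : Prim d) {q : Dual m} (hq : q ∈ Q.Cstar)
    (i : Fin N) : ConvexOn ℝ Q.U (Q.blockObj u q i) := by
  have h := (hQ.Jb_convexOn i).add (hQ.Phib_convexOn hq i)
  refine ⟨hQ.convex_U, fun x hx y hy a b ha hb hab => ?_⟩
  have h1 := h.2 hx hy ha hb hab
  have h2 : PiLp.single 2 i ((a • x + b • y) i) =
      a • (PiLp.single 2 i (x i) : Prim d) + b • PiLp.single 2 i (y i) := by
    ext j : 1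
    by_cases hj : j = i
    · subst hj; simp
    · simp [hj]
  simp only [Pi.add_apply, smul_eq_mul] at h1
  unfold blockObj
  rw [h2]
  simp only [map_add, map_smul, inner_add_right, inner_smul_right, PiLp.add_apply,
    PiLp.smul_apply, smul_eq_mul] at h1 ⊢
  linarith

theorem fderiv_inner_Om (hQ : Q.Standing BG T τ) (q : Dual m) {u : Prim d} (hu : u ∈ Q.U) :
    HasFDerivAt (fun x => (inner ℝ q (Q.Om x) : ℝ)) ((innerSL ℝ q).comp (fderiv ℝ Q.Om u)) u :=
  (innerSL ℝ q).hasFDerivAt.comp u (hQ.Om_diff u hu).hasFDerivAt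

/-- The linearized Lagrangian at `u` minorizes the Lagrangian. -/
theorem sum_blockObj_sub_le (hQ : Q.Standing BG T τ) {u y : Prim d} (hu : u ∈ Q.U) (hy : y ∈ Q.U)
    {q : Dual m} (hq : q ∈ Q.Cstar) :
    ∑ i, Q.blockObj u q i y - ∑ i, Q.blockObj u q i u ≤ Q.Lreal y q - Q.Lreal u q := by
  have h1 := tangent_le hQ.G_convex hu hy (hQ.G_diff u hu)
  have h2 := tangent_le (hQ.Om_convex.convexOn_inner hQ.convex_U hq) hu hy
    (hQ.fderiv_inner_Om q hu).differentiableAt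
  rw [(hQ.fderiv_inner_Om q hu).fderiv] at h2
  rw [sum_blockObj, sum_blockObj]
  unfold Lreal Theta
  rw [← inner_gradient_left] at h1
  simp only [ContinuousLinearMap.comp_apply, innerSL_apply_apply, map_sub, inner_sub_right,
    inner_add_right] at h1 h2 ⊢
  linarith

/-- The linearized Lagrangian at `u` majorizes the Lagrangian up to a quadratic term. -/
theorem sub_sum_blockObj_le (hQ : Q.Standing BG T τ) {u x : Prim d} (hu : u ∈ Q.U) (hx : x ∈ Q.U)
    {q : Dual m} (hq : q ∈ Q.Cstar) :
    ∑ i, Q.blockObj u q i u - ∑ i, Q.blockObj u q i x ≤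
      Q.Lreal u q - Q.Lreal x q + (BG + ‖q‖ * ‖T‖) / 2 * ‖u - x‖ ^ 2 := by
  have h1 := le_quadratic_of_fderiv_monotone hQ.convex_U hQ.G_diff (M := BG)
    (fun v hv w hw => by
      rw [sub_apply, ← inner_gradient_left, ← inner_gradient_left, ← inner_sub_left]
      refine (real_inner_le_norm _ _).trans ?_
      nlinarith [hQ.G_lip v hv w hw, norm_nonneg (v - w)]) hu hx
  have h2 := le_quadratic_of_fderiv_monotone hQ.convex_U
    (fun v hv => (hQ.fderiv_inner_Om q hv).differentiableAt) (M := ‖q‖ * ‖T‖)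
    (fun v hv w hw => by
      have h := inner_nonneg_of_mem hq (hQ.Om_curv v hv w hw)
      have h' := real_inner_le_norm q T
      rw [(hQ.fderiv_inner_Om q hv).fderiv, (hQ.fderiv_inner_Om q hw).fderiv, sub_apply]
      simp only [ContinuousLinearMap.comp_apply, innerSL_apply_apply]
      rw [inner_neg_right, inner_sub_right, inner_smul_right, sub_apply, inner_sub_right] at h
      nlinarith [sq_nonneg ‖v - w‖]) hu hx
  rw [(hQ.fderiv_inner_Om q hu).fderiv] at h2
  rw [sum_blockObj, sum_blockObj, norm_sub_rev]
  unfold Lreal Theta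
  rw [← inner_gradient_left] at h1
  simp only [ContinuousLinearMap.comp_apply, innerSL_apply_apply, map_sub, inner_sub_right,
    inner_add_right] at h1 h2 ⊢
  linarith

end Standing

end Problem

namespace Problem

variable {N : ℕ} {d : Fin N → ℕ} {m : ℕ} {Q : Problem d m}
  {BG τ β B γ ρ μ ε : ℝ} {T : Dual m} {Kb : ∀ i, EuclideanSpace ℝ (Fin (d i)) → ℝ}
  {i : Fin N} {u x : Prim d} {p q : Dual m}

/-! ### The primal step. -/

section PrimalStep

variable {K : Prim d → ℝ}

theorem Standing.primal_min (hQ : Q.Standing BG T τ) (hx : x ∈ Q.U)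
    (hmin : IsMinOn (Q.primalObj K i ε u q) Q.U x) {y : Prim d} (hy : y ∈ Q.U) :
    Q.blockObj u q i x + 1 / ε * bregman K x u ≤ Q.blockObj u q i y + 1 / ε * bregman K y u := by
  have h : Q.primalObj K i ε u q x ≤ Q.primalObj K i ε u q y := hmin hy
  rwa [hQ.primalObj_eq K i ε u q hx, hQ.primalObj_eq K i ε u q hy, EReal.coe_le_coe_iff] at h

theorem Standing.primal_prox (hQ : Q.Standing BG T τ) (hK : IsCore Q.U K β B)
    (hx : x ∈ Q.U) (hq : q ∈ Q.Cstar) (hε : 0 < ε)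
    (hmin : IsMinOn (Q.primalObj K i ε u q) Q.U x) {y : Prim d} (hy : y ∈ Q.U) :
    bregman K y x ≤ bregman K y u - bregman K x u +
      ε * (Q.blockObj u q i y - Q.blockObj u q i x) := by
  have h := hK.prox_inequality (hQ.blockObj_convexOn u hq i) (c := 1 / ε) x u hx
    (fun y hy => hQ.primal_min hx hmin hy) hy
  have h2 := mul_le_mul_of_nonneg_left h hε.le
  simp only [mul_add, ← mul_assoc, mul_one_div_cancel hε.ne', one_mul] at h2
  linarith

/-- The prox inequalities at the two minimizers, added together, contradict strong convexity unless
the points agree. Uniqueness makes the iterates functions of the block choices although the method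
takes any minimizer. -/
theorem Standing.primal_unique (hQ : Q.Standing BG T τ) (hK : IsCore Q.U K β B)
    (hq : q ∈ Q.Cstar) (hε : 0 < ε) {x x' : Prim d} (hx : x ∈ Q.U) (hx' : x' ∈ Q.U)
    (hmin : IsMinOn (Q.primalObj K i ε u q) Q.U x)
    (hmin' : IsMinOn (Q.primalObj K i ε u q) Q.U x') : x = x' := by
  have h1 := hQ.primal_prox hK hx hq hε hmin hx'
  have h2 := hQ.primal_prox hK hx' hq hε hmin' hx
  have h3 := hK.bregman_lower hx hx'
  have h4 := hK.bregman_lower hx' hx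
  rw [norm_sub_rev] at h4
  have h5 : β * ‖x - x'‖ ^ 2 ≤ 0 := by linarith
  have h6 : ‖x - x'‖ ^ 2 ≤ 0 := by
    by_contra hcon
    push Not at hcon
    nlinarith [mul_pos hK.beta_pos hcon]
  have h7 : ‖x - x'‖ = 0 := by nlinarith [norm_nonneg (x - x')]
  exact sub_eq_zero.1 (norm_eq_zero.1 h7)

/-- Only the selected block changes in a primal step. -/
theorem Standing.primal_block (hQ : Q.Standing BG T τ) (hK : IsCore Q.U (coreSum Kb) β B)
    (hu : u ∈ Q.U) (hx : x ∈ Q.U) (hε : 0 < ε)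
    (hmin : IsMinOn (Q.primalObj (coreSum Kb) i ε u q) Q.U x) {j : Fin N} (hj : j ≠ i) :
    x j = u j := by
  -- `v` moves only block `i` and `w` only the others, so the separable core splits `D(x, u)` as
  -- `D(v, u) + D(w, u)`. As `v` and `x` have equal block objectives, minimality of `x` forces `D(w,
  -- u) ≤ 0`, hence `w = u`.
  set v := setBlock u i (x i) with hv
  set w := setBlock x i (u i) with hw
  have hvU : v ∈ Q.U := setBlock_mem hu hx i
  have hwU : w ∈ Q.U := setBlock_mem hx hu i
  have hvw : v + w = u + x := by
    ext k : 1
    by_cases hk : k = i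
    · subst hk; simp [hv, hw, setBlock_same, add_comm]
    · simp [hv, hw, setBlock_of_ne _ hk]
  have hKs : coreSum Kb v + coreSum Kb w = coreSum Kb u + coreSum Kb x := by
    unfold coreSum
    rw [← Finset.sum_add_distrib, ← Finset.sum_add_distrib]
    refine Finset.sum_congr rfl fun k _ => ?_
    by_cases hk : k = i
    · subst hk; simp [hv, hw, setBlock_same, add_comm]
    · simp [hv, hw, setBlock_of_ne _ hk]
  have hsum : bregman (coreSum Kb) v u + bregman (coreSum Kb) w u =
      bregman (coreSum Kb) x u := by
    have h0 := bregman_self (coreSum Kb) u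
    unfold bregman at h0 ⊢
    have : (inner ℝ (gradient (coreSum Kb) u) (v - u) : ℝ) +
        inner ℝ (gradient (coreSum Kb) u) (w - u) = inner ℝ (gradient (coreSum Kb) u) (x - u) := by
      rw [← inner_add_right]
      congr 1
      calc v - u + (w - u) = (v + w) - u - u := by abel
        _ = x - u := by rw [hvw]; abel
    linarith
  have hobj : Q.blockObj u q i v = Q.blockObj u q i x := by
    unfold blockObj
    rw [hv, setBlock_same]
  have h1 := hQ.primal_min hx hmin hvU
  rw [hobj, ← hsum] at h1
  have h2 : 1 / ε * bregman (coreSum Kb) w u ≤ 0 := by linarith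
  have h3 := hK.bregman_lower hwU hu
  have h4 : 0 < 1 / ε := by positivity
  have h5 : ‖w - u‖ ^ 2 ≤ 0 := by
    by_contra hcon
    push Not at hcon
    nlinarith [mul_pos hK.beta_pos hcon, mul_pos h4 (mul_pos hK.beta_pos hcon)]
  have h7 : ‖w - u‖ = 0 := by nlinarith [norm_nonneg (w - u)]
  have h8 : w = u := sub_eq_zero.1 (norm_eq_zero.1 h7)
  rw [← h8, hw, setBlock_of_ne x hj]

theorem Standing.blockObj_sub_eq (hQ : Q.Standing BG T τ) (hK : IsCore Q.U (coreSum Kb) β B)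
    (hu : u ∈ Q.U) (hx : x ∈ Q.U) (hε : 0 < ε)
    (hmin : IsMinOn (Q.primalObj (coreSum Kb) i ε u q) Q.U x) :
    Q.blockObj u q i u - Q.blockObj u q i x =
      ∑ j, Q.blockObj u q j u - ∑ j, Q.blockObj u q j x := by
  rw [← Finset.sum_sub_distrib, Finset.sum_eq_single i]
  · intro j _ hj
    unfold blockObj
    rw [hQ.primal_block hK hu hx hε hmin hj, sub_self]
  · simp

/-- The difference from `y` to `x` is split at `u`. The part from `u` to `x` involves one block only
and so equals the full linearized decrease, which is compared with that of `Laug`; the part from `y`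
to `u` is kept for averaging over `i`. Of the `β / 2 * ‖u - x‖ ^ 2` supplied by the Bregman term,
the step cap lets the curvature consume half. -/
theorem Standing.primal_step (hQ : Q.Standing BG T τ) (hK : IsCore Q.U (coreSum Kb) β B)
    (hγ : 0 < γ) (hpos : 0 < BG + γ * τ ^ 2)
    (hu : u ∈ Q.U) (hx : x ∈ Q.U) (hε : 0 < ε)
    (hcap : ε ≤ stepCap BG τ β γ T (Q.q γ u p))
    (hmin : IsMinOn (Q.primalObj (coreSum Kb) i ε u (Q.q γ u p)) Q.U x) {y : Prim d}
    (hy : y ∈ Q.U) :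
    bregman (coreSum Kb) y x + ε * Q.Laug γ x p ≤ bregman (coreSum Kb) y u
      - β / 4 * ‖u - x‖ ^ 2 + ε * (Q.blockObj u (Q.q γ u p) i y - Q.blockObj u (Q.q γ u p) i u)
      + ε * Q.Laug γ u p := by
  have hq := Q.q_mem γ u p
  have h1 := hQ.primal_prox hK hx hq hε hmin hy
  have h2 := hQ.blockObj_sub_eq hK hu hx hε hmin
  have h3 := hQ.sub_sum_blockObj_le hu hx hq
  have h4 := hK.bregman_lower hx hu
  have h5 := augTerm_smooth Q.Cstar hγ (Q.Theta u) (Q.Theta x) p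
  change inner ℝ (Q.q γ u p) (Q.Theta u - Q.Theta x) ≤ _ at h5
  set q := Q.q γ u p
  have h6 : ‖Q.Theta x - Q.Theta u‖ ^ 2 ≤ τ ^ 2 * ‖u - x‖ ^ 2 := by
    obtain ⟨O, -, hUO, hO⟩ := hQ.Theta_lip
    rw [← mul_pow, norm_sub_rev]
    exact pow_le_pow_left₀ (norm_nonneg _) (hO u (hUO hu) x (hUO hx)) 2
  have h7 : Q.blockObj u q i u - Q.blockObj u q i x ≤ Q.Laug γ u p - Q.Laug γ x p +
      (BG + ‖q‖ * ‖T‖ + γ * τ ^ 2) / 2 * ‖u - x‖ ^ 2 := by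
    have h8 : γ / 2 * ‖Q.Theta x - Q.Theta u‖ ^ 2 ≤ γ / 2 * (τ ^ 2 * ‖u - x‖ ^ 2) := by gcongr
    rw [inner_sub_right] at h5
    unfold Lreal at h3
    unfold Laug
    linarith
  have h8 : ε * (BG + ‖q‖ * ‖T‖ + γ * τ ^ 2) ≤ β / 2 := by
    unfold stepCap at hcap
    have hD : 0 < BG + ‖q‖ * ‖T‖ + γ * τ ^ 2 := by
      have : 0 ≤ ‖q‖ * ‖T‖ := by positivity
      linarith
    rw [le_div_iff₀ (by positivity)] at hcap
    linarith
  have h9 : ε * (Q.blockObj u q i u - Q.blockObj u q i x) ≤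
      ε * (Q.Laug γ u p - Q.Laug γ x p) + β / 4 * ‖u - x‖ ^ 2 := by
    have := mul_le_mul_of_nonneg_left h7 hε.le
    have h10 := mul_le_mul_of_nonneg_right h8 (sq_nonneg ‖u - x‖)
    linarith
  rw [norm_sub_rev] at h4
  linarith

end PrimalStep

/-! ### The Lyapunov function and its mean decrease. -/

/-- The Lyapunov function of the method, relative to the saddle point `(us, ps)`. -/
def lyap (Q : Problem d m) (K : Prim d → ℝ) (γ : ℝ) (us : Prim d) (ps : Dual m) (ε : ℝ)
    (u : Prim d) (p : Dual m) : ℝ :=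
  bregman K us u + ε * ((2 * (N : ℝ) - 1) / (2 * N * γ) * ‖ps - p‖ ^ 2 +
    (1 - 1 / (N : ℝ)) * (Q.Laug γ u p - Q.Lreal us ps))

variable {us : Prim d} {ps : Dual m}

/-- `Laug` may fall below the saddle value, but by at most `‖ps - p‖ ^ 2 / (2γ)`. After weighting by
`1 - 1 / N`, the first term still leaves `‖ps - p‖ ^ 2 / (2γ)` to spare. -/
theorem lyap_coeff_nonneg (hN : 1 ≤ N) (hγ : 0 < γ) (hQ : Q.Standing BG T τ)
    (hs : Q.IsSaddle us ps) (hu : u ∈ Q.U) (p : Dual m) :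
    0 ≤ (2 * (N : ℝ) - 1) / (2 * N * γ) * ‖ps - p‖ ^ 2 +
      (1 - 1 / (N : ℝ)) * (Q.Laug γ u p - Q.Lreal us ps) := by
  obtain ⟨-, hps, -, hmin⟩ := hQ.isSaddle_iff.1 hs
  have h1 := hmin u hu
  have h2 := Q.Lreal_le_Laug hγ u p hps
  have hN' : (1:ℝ) ≤ N := by exact_mod_cast hN
  have hn1 : 0 ≤ 1 - 1 / (N:ℝ) := by
    rw [sub_nonneg, div_le_one (by linarith)]; exact hN'
  have h3 : (1 - 1 / (N : ℝ)) * -(‖ps - p‖ ^ 2 / (2 * γ)) ≤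
      (1 - 1 / (N : ℝ)) * (Q.Laug γ u p - Q.Lreal us ps) :=
    mul_le_mul_of_nonneg_left (by linarith) hn1
  have h4 : (2 * (N : ℝ) - 1) / (2 * N * γ) * ‖ps - p‖ ^ 2 +
      (1 - 1 / (N : ℝ)) * -(‖ps - p‖ ^ 2 / (2 * γ)) = ‖ps - p‖ ^ 2 / (2 * γ) := by
    have : (N:ℝ) ≠ 0 := by positivity
    field_simp
    ring
  have h5 : 0 ≤ ‖ps - p‖ ^ 2 / (2 * γ) := by positivity
  linarith

theorem le_lyap (hN : 1 ≤ N) (hγ : 0 < γ) (hQ : Q.Standing BG T τ) {K : Prim d → ℝ}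
    (hK : IsCore Q.U K β B) (hs : Q.IsSaddle us ps) (hu : u ∈ Q.U) (p : Dual m) (hε : 0 ≤ ε) :
    β / 2 * ‖us - u‖ ^ 2 ≤ Q.lyap K γ us ps ε u p := by
  have h1 := hK.bregman_lower hs.1 hu
  have h2 := mul_nonneg hε (lyap_coeff_nonneg hN hγ hQ hs hu p)
  unfold lyap
  linarith

theorem lyap_mono (hN : 1 ≤ N) (hγ : 0 < γ) (hQ : Q.Standing BG T τ) (K : Prim d → ℝ)
    (hs : Q.IsSaddle us ps) (hu : u ∈ Q.U) (p : Dual m) {ε' : ℝ} (h : ε' ≤ ε) :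
    Q.lyap K γ us ps ε' u p ≤ Q.lyap K γ us ps ε u p := by
  have h2 := mul_le_mul_of_nonneg_right h (lyap_coeff_nonneg hN hγ hQ hs hu p)
  unfold lyap
  linarith

/-- The change of the Lyapunov function along one step with block `i`. -/
theorem lyap_step (hN : 1 ≤ N) (hQ : Q.Standing BG T τ) (hK : IsCore Q.U (coreSum Kb) β B)
    (hγ : 0 < γ) (hρ : ρ = γ / (2 * (N : ℝ) - 1)) (hpos : 0 < BG + γ * τ ^ 2)
    (hs : Q.IsSaddle us ps) (hpsμ : ‖ps‖ ≤ μ) (hpμ : ‖p‖ ≤ μ)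
    (hu : u ∈ Q.U) (hx : x ∈ Q.U) (hε : 0 < ε)
    (hcap : ε ≤ stepCap BG τ β γ T (Q.q γ u p))
    (hmin : IsMinOn (Q.primalObj (coreSum Kb) i ε u (Q.q γ u p)) Q.U x) {p' : Dual m}
    (hp' : p' = nearestPoint (Metric.closedBall (0 : Dual m) μ)
      (p + (ρ / γ) • (Q.q γ x p - p))) :
    Q.lyap (coreSum Kb) γ us ps ε x p' ≤ Q.lyap (coreSum Kb) γ us ps ε u p
      - β / 4 * ‖u - x‖ ^ 2
      + ε * (Q.blockObj u (Q.q γ u p) i us - Q.blockObj u (Q.q γ u p) i u)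
      + ε * (1 / N * (Q.Laug γ u p - Q.Lreal us ps)) := by
  obtain ⟨hus, hps, -, hsmin⟩ := hQ.isSaddle_iff.1 hs
  have hN' : (1:ℝ) ≤ N := by exact_mod_cast hN
  have h1 := hQ.primal_step hK hγ hpos hu hx hε hcap hmin hus
  have h2 := dual_step Q.Cstar hγ hN' hρ (Q.Theta x) p hps hpsμ hpμ
  have hp'' : p' = nearestPoint (Metric.closedBall (0 : Dual m) μ)
      (p + (ρ / γ) • (nearestPoint (Q.Cstar : Set (Dual m)) (p + γ • Q.Theta x) - p)) := hp'
  rw [← hp''] at h2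
  -- The share `1 / N * ⟪ps, Θ x⟫` left by `dual_step` completes to a share of the Lagrangian at
  -- `(x, ps)`, which is at least the saddle value.
  have h3 : 1 / (N:ℝ) * Q.Lreal us ps ≤ 1 / (N:ℝ) * Q.Lreal x ps :=
    mul_le_mul_of_nonneg_left (hsmin x hx) (by positivity)
  have h4 : (2 * (N : ℝ) - 1) / (2 * N * γ) * ‖ps - p'‖ ^ 2 +
      (1 - 1 / (N : ℝ)) * (Q.Laug γ x p' - Q.Lreal us ps) ≤
      (2 * (N : ℝ) - 1) / (2 * N * γ) * ‖ps - p‖ ^ 2 + (Q.Laug γ x p - Q.Lreal us ps) := by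
    unfold Lreal at h3 ⊢
    unfold Laug
    linarith
  have h5 := mul_le_mul_of_nonneg_left h4 hε.le
  unfold lyap
  linarith

/-- The mean change of the Lyapunov function over all blocks. -/
theorem sum_lyap_step (hN : 1 ≤ N) (hQ : Q.Standing BG T τ) (hK : IsCore Q.U (coreSum Kb) β B)
    (hγ : 0 < γ) (hρ : ρ = γ / (2 * (N : ℝ) - 1)) (hpos : 0 < BG + γ * τ ^ 2)
    (hs : Q.IsSaddle us ps) (hpsμ : ‖ps‖ ≤ μ) (hpμ : ‖p‖ ≤ μ)
    (hu : u ∈ Q.U) {x : Fin N → Prim d} (hx : ∀ i, x i ∈ Q.U) (hε : 0 < ε)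
    (hcap : ε ≤ stepCap BG τ β γ T (Q.q γ u p))
    (hmin : ∀ i, IsMinOn (Q.primalObj (coreSum Kb) i ε u (Q.q γ u p)) Q.U (x i))
    {p' : Fin N → Dual m}
    (hp' : ∀ i, p' i = nearestPoint (Metric.closedBall (0 : Dual m) μ)
      (p + (ρ / γ) • (Q.q γ (x i) p - p)))
    {ε' : Fin N → ℝ} (hε' : ∀ i, ε' i ≤ ε) :
    (N : ℝ)⁻¹ * ∑ i, Q.lyap (coreSum Kb) γ us ps (ε' i) (x i) (p' i) ≤
      Q.lyap (coreSum Kb) γ us ps ε u p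
      - (N : ℝ)⁻¹ * ∑ i, β / 4 * ‖u - x i‖ ^ 2
      - ε / (2 * N * γ) * ‖Q.q γ u p - p‖ ^ 2 := by
  have hN0 : (0:ℝ) < N := by exact_mod_cast hN
  have h1 : ∀ i, Q.lyap (coreSum Kb) γ us ps (ε' i) (x i) (p' i) ≤
      Q.lyap (coreSum Kb) γ us ps ε u p + ε * (1 / N * (Q.Laug γ u p - Q.Lreal us ps))
      - β / 4 * ‖u - x i‖ ^ 2
      + ε * (Q.blockObj u (Q.q γ u p) i us - Q.blockObj u (Q.q γ u p) i u) := fun i => by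
    have h := (lyap_mono hN hγ hQ (coreSum Kb) hs (hx i) (p' i) (hε' i)).trans
      (lyap_step hN hQ hK hγ hρ hpos hs hpsμ hpμ hu (hx i) hε hcap (hmin i) (hp' i))
    linarith
  have h2 := Finset.sum_le_sum fun i (_ : i ∈ Finset.univ) => h1 i
  rw [Finset.sum_add_distrib, Finset.sum_sub_distrib, ← Finset.mul_sum, Finset.sum_const,
    Finset.card_univ, Fintype.card_fin, nsmul_eq_mul, ← Finset.mul_sum, Finset.sum_sub_distrib] at h2
  -- The summed differences are at most `L(us, ps) - L(u, q)`, and `L(u, q)` exceeds `Laug` by `‖q -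
  -- p‖ ^ 2 / (2γ)`. This cancels the drift in `Laug` and leaves the negative residual.
  have h3 := hQ.sum_blockObj_sub_le hu hs.1 (Q.q_mem γ u p)
  have h4 := (hQ.isSaddle_iff.1 hs).2.2.1 _ (Q.q_mem γ u p)
  rw [Q.Lreal_q_eq hγ u p] at h3
  have h5 := mul_le_mul_of_nonneg_left (h3.trans (sub_le_sub_right h4 _)) hε.le
  have h6 := mul_le_mul_of_nonneg_left (h2.trans (add_le_add_right h5 _)) (inv_nonneg.2 hN0.le)
  refine h6.trans (le_of_eq ?_)
  rw [← Finset.mul_sum]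
  field_simp
  ring

end Problem

/-! ### Functions of the block choices, conditional means and supermartingales. -/

section Past

variable {S : Type*} {N : ℕ}

/-- `f` is a function of `i(0), …, i(k-1)`. -/
def DependsOnPast {α : Type*} (idx : ℕ → S → Fin N) (k : ℕ) (f : S → α) : Prop :=
  ∀ ω ω', (∀ j < k, idx j ω = idx j ω') → f ω = f ω'

theorem DependsOnPast.mono {α : Type*} {idx : ℕ → S → Fin N} {k l : ℕ} {f : S → α}
    (hf : DependsOnPast idx k f) (hkl : k ≤ l) : DependsOnPast idx l f :=
  fun ω ω' h => hf ω ω' fun j hj => h j (hj.trans_le hkl)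

theorem past_mono (idx : ℕ → S → Fin N) : Monotone (past idx) := fun _ l h =>
  iSup_le fun j => le_iSup_of_le (⟨j, j.2.trans_le h⟩ : Fin l) le_rfl

theorem past_eq_biSup (idx : ℕ → S → Fin N) (k : ℕ) :
    past idx k = ⨆ j ∈ Set.Iio k, MeasurableSpace.comap (idx j) inferInstance := by
  refine le_antisymm (iSup_le fun j => le_iSup₂_of_le (j : ℕ) j.2 le_rfl)
    (iSup₂_le fun j hj => le_iSup_of_le (⟨j, hj⟩ : Fin k) le_rfl)

theorem DependsOnPast.exists_eq_comp {α : Type*} [Nonempty α] {idx : ℕ → S → Fin N} {k : ℕ}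
    {f : S → α} (hf : DependsOnPast idx k f) :
    ∃ g : (Fin k → Fin N) → α, f = g ∘ fun ω j => idx j ω :=
  (Function.factorsThrough_iff f).1 fun ω ω' h => hf ω ω' fun j hj => congrFun h ⟨j, hj⟩

theorem measurable_history (idx : ℕ → S → Fin N) (k : ℕ) :
    Measurable[past idx k] fun ω (j : Fin k) => idx j ω := by
  let := past idx k
  exact measurable_pi_lambda _ fun j => Measurable.mono (comap_measurable (idx j))
    (le_iSup (fun j : Fin k => MeasurableSpace.comap (idx j) inferInstance) j) le_rfl

/-- Such an `f` factors through the finite set of histories, where every function is measurable; no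
measurable selection of minimizers is needed. -/
theorem DependsOnPast.stronglyMeasurable {idx : ℕ → S → Fin N} {k : ℕ} {f : S → ℝ}
    (hf : DependsOnPast idx k f) : StronglyMeasurable[past idx k] f := by
  obtain ⟨g, rfl⟩ := hf.exists_eq_comp
  exact Measurable.stronglyMeasurable
    ((measurable_of_finite g).comp (measurable_history idx k))

/-- The map `br` is an arbitrary choice, possibly not measurable, but `f` sees only the history of
`br ω`, which the first `k` choices at `ω` and `i` determine. -/
theorem DependsOnPast.comp_branch {α : Type*} {idx : ℕ → S → Fin N} {k : ℕ} {f : S → α}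
    (hf : DependsOnPast idx (k + 1) f) {br : S → S} {i : Fin N}
    (hbr : ∀ ω, (∀ j < k, idx j (br ω) = idx j ω) ∧ idx k (br ω) = i) :
    DependsOnPast idx k fun ω => f (br ω) := by
  intro ω ω' h
  refine hf _ _ fun j hj => ?_
  rcases Nat.lt_succ_iff_lt_or_eq.1 hj with hj | rfl
  · rw [(hbr ω).1 j hj, (hbr ω').1 j hj, h j hj]
  · rw [(hbr ω).2, (hbr ω').2]

variable [MeasurableSpace S] {idx : ℕ → S → Fin N}

theorem past_le (hmeas : ∀ k, Measurable (idx k)) (k : ℕ) : past idx k ≤ ‹MeasurableSpace S› :=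
  iSup_le fun j => (hmeas j).comap_le

/-- The filtration of the block choices, starting with `i(0)`. -/
def pastFiltration (hmeas : ∀ k, Measurable (idx k)) : Filtration ℕ ‹MeasurableSpace S› where
  seq k := past idx (k + 1)
  mono' _ _ h := past_mono idx (Nat.succ_le_succ h)
  le' k := past_le hmeas (k + 1)

variable {P : Measure S}

theorem DependsOnPast.integrable [IsProbabilityMeasure P]
    (hmeas : ∀ k, Measurable (idx k)) {k : ℕ} {f : S → ℝ}
    (hf : DependsOnPast idx k f) : Integrable f P := by
  have hm := (hf.stronglyMeasurable.mono (past_le hmeas k)).aestronglyMeasurable (μ := P)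
  obtain ⟨g, rfl⟩ := hf.exists_eq_comp
  obtain ⟨C, hC⟩ := (Set.finite_range fun x => ‖g x‖).bddAbove
  exact Integrable.of_bound hm C (Filter.Eventually.of_forall fun ω => hC ⟨_, rfl⟩)

/-- Every finite sequence of block choices occurs. -/
theorem exists_history (hindep : iIndepFun idx P)
    (hunif : ∀ k i, P {ω | idx k ω = i} = (N : ENNReal)⁻¹) (k : ℕ) (w : ℕ → Fin N) :
    ∃ ω, ∀ j < k, idx j ω = w j := by
  have h := hindep.measure_inter_preimage_eq_mul (Finset.range k) (sets := fun j => {w j})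
    fun j _ => MeasurableSet.singleton _
  have h2 : ∀ j, P (idx j ⁻¹' {w j}) = (N : ENNReal)⁻¹ := fun j => hunif j (w j)
  simp only [h2, Finset.prod_const, Finset.card_range] at h
  have h3 : P (⋂ j ∈ Finset.range k, idx j ⁻¹' {w j}) ≠ 0 := by
    rw [h]
    exact pow_ne_zero _ (ENNReal.inv_ne_zero.2 (ENNReal.natCast_ne_top N))
  obtain ⟨ω, hω⟩ := nonempty_of_measure_ne_zero h3
  refine ⟨ω, fun j hj => ?_⟩
  simp only [Set.mem_iInter] at hω
  exact hω j (Finset.mem_range.2 hj)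

/-- The choice `i(k) = i` is possible after every history. -/
theorem exists_branch (hindep : iIndepFun idx P)
    (hunif : ∀ k i, P {ω | idx k ω = i} = (N : ENNReal)⁻¹) (k : ℕ) (i : Fin N) (ω : S) :
    ∃ ω', (∀ j < k, idx j ω' = idx j ω) ∧ idx k ω' = i := by
  obtain ⟨ω', h⟩ := exists_history hindep hunif (k + 1)
    (fun j => if j < k then idx j ω else i)
  refine ⟨ω', fun j hj => ?_, ?_⟩
  · rw [h j (by omega), if_pos hj]
  · rw [h k (by omega), if_neg (lt_irrefl k)]

/-- The conditional expectation given the past is the mean over the next block choice. -/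
theorem condExp_past_eq [IsProbabilityMeasure P]
    (hmeas : ∀ k, Measurable (idx k)) (hindep : iIndepFun idx P)
    (hunif : ∀ k i, P {ω | idx k ω = i} = (N : ENNReal)⁻¹) {k : ℕ} {f : S → ℝ}
    (hf : DependsOnPast idx (k + 1) f) {br : Fin N → S → S}
    (hbr : ∀ i ω, (∀ j < k, idx j (br i ω) = idx j ω) ∧ idx k (br i ω) = i) :
    P[f | past idx k] =ᵐ[P] fun ω => (N : ℝ)⁻¹ * ∑ i, f (br i ω) := by
  set X : Fin N → S → ℝ := fun i => (idx k ⁻¹' {i}).indicator fun _ => (1:ℝ) with hX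
  have hset : ∀ i, MeasurableSet[MeasurableSpace.comap (idx k) inferInstance] (idx k ⁻¹' {i}) :=
    fun i => ⟨{i}, MeasurableSet.singleton i, rfl⟩
  have hXm : ∀ i, StronglyMeasurable[MeasurableSpace.comap (idx k) inferInstance] (X i) :=
    fun i => stronglyMeasurable_const.indicator (hset i)
  have hXint : ∀ i, Integrable (X i) P := fun i =>
    (integrable_const (1:ℝ)).indicator ((hmeas k) (MeasurableSet.singleton i))
  have hXdep : ∀ i, DependsOnPast idx (k + 1) (X i) := fun i ω ω' h => by
    simp only [hX, Set.indicator, Set.mem_preimage, h k (by omega)]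
  have hfb : ∀ i, DependsOnPast idx k fun ω => f (br i ω) := fun i => hf.comp_branch (hbr i)
  -- Splitting by the value of the next choice makes each term a function of the past times an
  -- indicator independent of the past, with mean `1 / N`.
  have hdecomp : f = ∑ i, (fun ω => f (br i ω)) * X i := by
    funext ω
    rw [Finset.sum_apply, Finset.sum_eq_single (idx k ω)]
    · have : f ω = f (br (idx k ω) ω) := hf _ _ fun j hj => by
        rcases Nat.lt_succ_iff_lt_or_eq.1 hj with hj | rfl
        · rw [(hbr _ ω).1 j hj]
        · rw [(hbr _ ω).2]
      simp [hX, ← this]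
    · intro i _ hi
      simp [hX, Set.indicator, hi.symm]
    · simp
  have hint : ∀ i, Integrable ((fun ω => f (br i ω)) * X i) P := fun i =>
    DependsOnPast.integrable hmeas (k := k + 1) fun ω ω' h =>
      congrArg₂ (· * ·) ((hfb i).mono (Nat.le_succ k) ω ω' h) (hXdep i ω ω' h)
  have hind : Indep (MeasurableSpace.comap (idx k) inferInstance) (past idx k) P := by
    have := indep_iSup_of_disjoint (fun j => (hmeas j).comap_le) hindep
      (S := {k}) (T := Set.Iio k) (by simp)
    rwa [← past_eq_biSup, iSup_singleton] at this
  have hX0 : ∀ i, P[X i | past idx k] =ᵐ[P] fun _ => (N : ℝ)⁻¹ := fun i => by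
    refine (condExp_indep_eq (hmeas k).comap_le (past_le hmeas k) (hXm i) hind).trans ?_
    have : ∫ ω, X i ω ∂P = (N : ℝ)⁻¹ := by
      rw [hX, integral_indicator_const _ ((hmeas k) (MeasurableSet.singleton i)), smul_eq_mul,
        mul_one, Measure.real]
      change (P {ω | idx k ω = i}).toReal = _
      rw [hunif]
      simp
    rw [this]
  have hterm : ∀ i, P[(fun ω => f (br i ω)) * X i | past idx k] =ᵐ[P]
      fun ω => f (br i ω) * (N : ℝ)⁻¹ := fun i => by
    refine (condExp_mul_of_stronglyMeasurable_left (hfb i).stronglyMeasurable (hint i)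
      (hXint i)).trans ?_
    filter_upwards [hX0 i] with ω hω
    rw [Pi.mul_apply, hω]
  have hsum := condExp_finsetSum (s := Finset.univ) (fun i _ => hint i) (past idx k)
  rw [← hdecomp] at hsum
  refine hsum.trans ?_
  filter_upwards [ae_all_iff.2 hterm] with ω hω
  rw [Finset.sum_apply, Finset.sum_congr rfl fun i _ => hω i, ← Finset.sum_mul, mul_comm]

/-- A nonnegative process whose mean decrease dominates nonnegative terms is almost surely
bounded, and these terms are almost surely summable. -/
theorem ae_bounded_and_summable [IsProbabilityMeasure P]
    (hmeas : ∀ k, Measurable (idx k))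
    {V A : ℕ → S → ℝ} (hV : ∀ k, DependsOnPast idx (k + 1) (V k))
    (hA : ∀ k, DependsOnPast idx (k + 1) (A k)) (hV0 : ∀ k ω, 0 ≤ V k ω) (hA0 : ∀ k ω, 0 ≤ A k ω)
    (hdec : ∀ k, P[V (k + 1) | past idx (k + 1)] ≤ᵐ[P] fun ω => V k ω - A k ω) :
    ∀ᵐ ω ∂P, (∃ R, ∀ k, V k ω ≤ R) ∧ Summable fun k => A k ω := by
  -- Adding back the accumulated decrease gives a nonnegative supermartingale. Its negative is an
  -- `L¹`-bounded submartingale, so `W` converges almost surely and bounds both summands.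
  set W : ℕ → S → ℝ := fun k ω => V k ω + ∑ j ∈ Finset.range k, A j ω with hW
  have hsumdep : ∀ k, DependsOnPast idx k (fun ω => ∑ j ∈ Finset.range k, A j ω) :=
    fun k ω ω' h => Finset.sum_congr rfl fun j hj =>
      hA j ω ω' fun l hl => h l (by have := Finset.mem_range.1 hj; omega)
  have hWdep : ∀ k, DependsOnPast idx (k + 1) (W k) := fun k ω ω' h =>
    congrArg₂ (· + ·) (hV k ω ω' h) ((hsumdep k).mono (Nat.le_succ k) ω ω' h)
  have hWint : ∀ k, Integrable (W k) P := fun k => (hWdep k).integrable hmeas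
  have hsup : Supermartingale W (pastFiltration hmeas) P := by
    refine supermartingale_nat (fun k => (hWdep k).stronglyMeasurable) hWint fun k => ?_
    have h1 : P[W (k + 1) | past idx (k + 1)] =ᵐ[P] P[V (k + 1) | past idx (k + 1)] +
        fun ω => ∑ j ∈ Finset.range (k + 1), A j ω := by
      have h2 : W (k + 1) = V (k + 1) + fun ω => ∑ j ∈ Finset.range (k + 1), A j ω := rfl
      rw [h2]
      refine (condExp_add ((hV (k + 1)).integrable hmeas)
        ((hsumdep (k + 1)).integrable hmeas) _).trans ?_
      rw [condExp_of_stronglyMeasurable (past_le hmeas (k + 1))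
        (hsumdep (k + 1)).stronglyMeasurable ((hsumdep (k + 1)).integrable hmeas)]
    change P[W (k + 1) | past idx (k + 1)] ≤ᵐ[P] W k
    filter_upwards [h1, hdec k] with ω h1 h2
    rw [h1, Pi.add_apply, Finset.sum_range_succ]
    simp only [hW]
    linarith
  have hW0 : ∀ k ω, 0 ≤ W k ω := fun k ω =>
    add_nonneg (hV0 k ω) (Finset.sum_nonneg fun j _ => hA0 j ω)
  have hbdd : ∀ k, eLpNorm (-W k) 1 P ≤ (Real.toNNReal (∫ ω, W 0 ω ∂P) : ENNReal) := fun k => by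
    rw [eLpNorm_neg, eLpNorm_one_eq_lintegral_enorm, ← ofReal_integral_norm_eq_lintegral_enorm
      (hWint k)]
    refine ENNReal.ofReal_le_ofReal ?_
    simp only [Real.norm_of_nonneg (hW0 k _)]
    have := hsup.setIntegral_le (Nat.zero_le k) MeasurableSet.univ
    simpa using this
  filter_upwards [hsup.neg.ae_tendsto_limitProcess hbdd] with ω hω
  obtain ⟨R, hR⟩ := hω.bddBelow_range
  have hWR : ∀ k, W k ω ≤ -R := fun k => by
    have : R ≤ -W k ω := hR ⟨k, rfl⟩
    linarith
  refine ⟨⟨-R, fun k => ?_⟩, summable_of_sum_range_le (c := -R) (fun k => hA0 k ω) fun k => ?_⟩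
  · have h1 := hWR k
    have h2 := Finset.sum_nonneg fun j (_ : j ∈ Finset.range k) => hA0 j ω
    simp only [hW] at h1
    linarith
  · have h1 := hWR k
    have h2 := hV0 k ω
    simp only [hW] at h1
    linarith

end Past

/-! ### From vanishing residuals to saddle points. -/

namespace Problem

open Filter Topology

variable {N : ℕ} {d : Fin N → ℕ} {m : ℕ} {Q : Problem d m}
  {BG τ β B γ ρ μ : ℝ} {T : Dual m} {K : Prim d → ℝ}

theorem Standing.Theta_lip_on (hQ : Q.Standing BG T τ) {u v : Prim d} (hu : u ∈ Q.U)
    (hv : v ∈ Q.U) : ‖Q.Theta u - Q.Theta v‖ ≤ τ * ‖u - v‖ := by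
  obtain ⟨O, -, hUO, hO⟩ := hQ.Theta_lip
  exact hO u (hUO hu) v (hUO hv)

theorem Standing.tendsto_Theta (hQ : Q.Standing BG T τ) {u : ℕ → Prim d} {ub : Prim d}
    (hu : ∀ k, u k ∈ Q.U) (hub : ub ∈ Q.U) (h : Tendsto u atTop (𝓝 ub)) :
    Tendsto (fun k => Q.Theta (u k)) atTop (𝓝 (Q.Theta ub)) := by
  rw [tendsto_iff_norm_sub_tendsto_zero] at h ⊢
  refine squeeze_zero (fun _ => norm_nonneg _) (fun k => hQ.Theta_lip_on (hu k) hub) ?_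
  simpa using h.const_mul τ

/-- The near-optimality in the Lagrangian of the vector assembled from the block updates. -/
theorem Standing.Lreal_assembled_le (hQ : Q.Standing BG T τ) (hK : IsCore Q.U K β B)
    {u : Prim d} (hu : u ∈ Q.U) {q : Dual m} (hq : q ∈ Q.Cstar) {ε e : ℝ} (he : 0 < e)
    (heε : e ≤ ε) {x : Fin N → Prim d} (hx : ∀ i, x i ∈ Q.U)
    (hmin : ∀ i, IsMinOn (Q.primalObj K i ε u q) Q.U (x i)) {w : Prim d} (hw : ∀ i, w i = x i i)
    {y : Prim d} (hy : y ∈ Q.U) :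
    Q.Lreal w q ≤ Q.Lreal y q + (BG + ‖q‖ * ‖T‖) / 2 * ‖u - w‖ ^ 2 +
      (∑ i, |B| * ‖x i - u‖ * ‖y - x i‖) / e := by
  have hε : 0 < ε := he.trans_le heε
  have hwU : w ∈ Q.U := fun i => by rw [hw]; exact hx i i
  -- By the three-point identity the prox error is at most `⟪∇K (x i) - ∇K u, y - x i⟫`, which is
  -- small with `x i - u`. The sign of `B` is not assumed, hence `|B|`.
  have h1 : ∀ i, ε * (Q.blockObj u q i w - Q.blockObj u q i y) ≤
      |B| * ‖x i - u‖ * ‖y - x i‖ := fun i => by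
    have h := hQ.primal_prox hK (hx i) hq hε (hmin i) hy
    have h2 := bregman_three_point K (x i) y u
    have h3 := real_inner_le_norm (gradient K (x i) - gradient K u) (y - x i)
    have h4 : ‖gradient K (x i) - gradient K u‖ ≤ |B| * ‖x i - u‖ :=
      (hK.lip _ (hx i) _ hu).trans (mul_le_mul_of_nonneg_right (le_abs_self B) (norm_nonneg _))
    have h5 := mul_le_mul_of_nonneg_right h4 (norm_nonneg (y - x i))
    have h6 : Q.blockObj u q i w = Q.blockObj u q i (x i) := by
      unfold blockObj; rw [hw]
    rw [h6]
    linarith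
  have h2 := Finset.sum_le_sum fun i (_ : i ∈ Finset.univ) => h1 i
  rw [← Finset.mul_sum, Finset.sum_sub_distrib] at h2
  have h3 := hQ.sum_blockObj_sub_le hu hy hq
  have h4 := hQ.sub_sum_blockObj_le hu hwU hq
  set δ := ∑ i, |B| * ‖x i - u‖ * ‖y - x i‖ with hδ
  have hδ0 : 0 ≤ δ := Finset.sum_nonneg fun i _ => by positivity
  have h5 : ∑ i, Q.blockObj u q i w - ∑ i, Q.blockObj u q i y ≤ δ / e := by
    refine le_trans ?_ (div_le_div_of_nonneg_left hδ0 he heε)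
    rw [le_div_iff₀ hε]
    linarith
  linarith

/-- Limits of primal-dual pairs along which the residuals vanish are saddle points. -/
theorem Standing.isSaddle_of_tendsto (hQ : Q.Standing BG T τ) (hK : IsCore Q.U K β B)
    (hγ : 0 < γ) {u : ℕ → Prim d} {p : ℕ → Dual m} {ε : ℕ → ℝ} {x : ℕ → Fin N → Prim d}
    {ub : Prim d} {pb : Dual m} {e : ℝ} (he : 0 < e) (heε : ∀ k, e ≤ ε k)
    (hu : ∀ k, u k ∈ Q.U) (hx : ∀ k i, x k i ∈ Q.U)
    (hmin : ∀ k i, IsMinOn (Q.primalObj K i (ε k) (u k) (Q.q γ (u k) (p k))) Q.U (x k i))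
    (hut : Tendsto u atTop (𝓝 ub)) (hpt : Tendsto p atTop (𝓝 pb))
    (hxt : ∀ i, Tendsto (fun k => x k i) atTop (𝓝 ub))
    (hqt : Tendsto (fun k => Q.q γ (u k) (p k)) atTop (𝓝 pb)) :
    Q.IsSaddle ub pb := by
  have hub : ub ∈ Q.U := hQ.closed_U.mem_of_tendsto hut (Eventually.of_forall hu)
  have hpb : pb ∈ Q.Cstar := Q.Cstar.isClosed.mem_of_tendsto hqt
    (Eventually.of_forall fun k => Q.q_mem γ (u k) (p k))
  have hΘ := hQ.tendsto_Theta hu hub hut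
  refine hQ.isSaddle_iff.2 ⟨hub, hpb, fun r hr => ?_, fun y hy => ?_⟩
  · have h1 : ∀ k, (inner ℝ (p k + γ • Q.Theta (u k) - Q.q γ (u k) (p k))
        (r - Q.q γ (u k) (p k)) : ℝ) ≤ 0 := fun k => cone_projection_inner_le Q.Cstar _ hr
    have h2 := ((hpt.add (hΘ.const_smul γ)).sub hqt).inner (𝕜 := ℝ)
      ((tendsto_const_nhds (x := r)).sub hqt)
    have h3 := le_of_tendsto' h2 h1
    rw [add_sub_cancel_left, inner_smul_left, inner_sub_right, real_inner_comm,
      real_inner_comm pb] at h3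
    have h4 : (inner ℝ r (Q.Theta ub) : ℝ) - inner ℝ pb (Q.Theta ub) ≤ 0 := by
      by_contra hcon
      push Not at hcon
      have := mul_pos hγ hcon
      simp only [conj_trivial] at h3
      linarith
    unfold Lreal
    linarith
  · set q : ℕ → Dual m := fun k => Q.q γ (u k) (p k) with hq
    set w : ℕ → Prim d := fun k => WithLp.toLp 2 fun i => x k i i with hw
    have hwt : Tendsto w atTop (𝓝 ub) := by
      have h1 : Tendsto (fun k i => x k i i) atTop (𝓝 fun i => ub i) :=
        tendsto_pi_nhds.2 fun i => ((PiLp.continuous_apply 2 _ i).tendsto ub).comp (hxt i)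
      exact ((PiLp.continuous_toLp 2 _).tendsto fun i => ub i).comp h1
    have hwU : ∀ k, w k ∈ Q.U := fun k i => hx k i i
    have hle : ∀ k, Q.Lreal (w k) (q k) ≤ Q.Lreal y (q k) +
        (BG + ‖q k‖ * ‖T‖) / 2 * ‖u k - w k‖ ^ 2 +
        (∑ i, |B| * ‖x k i - u k‖ * ‖y - x k i‖) / e := fun k =>
      hQ.Lreal_assembled_le hK (hu k) (Q.q_mem γ (u k) (p k)) he (heε k) (hx k) (hmin k)
        (fun i => rfl) hy
    have hLy : Tendsto (fun k => Q.Lreal y (q k)) atTop (𝓝 (Q.Lreal y pb)) :=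
      ((hqt.inner tendsto_const_nhds).const_add _).const_add _
    have herr1 : Tendsto (fun k => (BG + ‖q k‖ * ‖T‖) / 2 * ‖u k - w k‖ ^ 2) atTop (𝓝 0) := by
      have := (((hqt.norm.mul_const ‖T‖).const_add BG).div_const 2).mul ((hut.sub hwt).norm.pow 2)
      simpa using this
    have herr2 : Tendsto (fun k => (∑ i, |B| * ‖x k i - u k‖ * ‖y - x k i‖) / e) atTop
        (𝓝 0) := by
      have : Tendsto (fun k => (∑ i, |B| * ‖x k i - u k‖ * ‖y - x k i‖) / e) atTop
          (𝓝 ((∑ i : Fin N, |B| * ‖ub - ub‖ * ‖y - ub‖) / e)) :=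
        (tendsto_finsetSum _ fun i _ => ((((hxt i).sub hut).norm.const_mul |B|).mul
          ((tendsto_const_nhds (x := y)).sub (hxt i)).norm)).div_const e
      simpa using this
    have hGt : Tendsto (fun k => Q.G (w k)) atTop (𝓝 (Q.G ub)) :=
      (hQ.G_diff ub hub).continuousAt.tendsto.comp hwt
    have hΘw := hqt.inner (𝕜 := ℝ) (hQ.tendsto_Theta hwU hub hwt)
    have hR := ((hLy.add herr1).add herr2).sub (hGt.add hΘw)
    rw [add_zero, add_zero] at hR
    have hJle : ∀ k, Q.Jreal (w k) ≤ Q.Lreal y (q k) +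
        (BG + ‖q k‖ * ‖T‖) / 2 * ‖u k - w k‖ ^ 2 +
        (∑ i, |B| * ‖x k i - u k‖ * ‖y - x k i‖) / e -
        (Q.G (w k) + inner ℝ (q k) (Q.Theta (w k))) := fun k => by
      have := hle k
      rw [Lreal] at this
      linarith
    -- Only lower semicontinuity of `J` is at hand: a value `a` strictly inside a supposed gap would
    -- eventually lie below `J (w k)` and above its upper bound.
    have hmain : Q.Jreal ub ≤ Q.Lreal y pb - (Q.G ub + inner ℝ pb (Q.Theta ub)) := by
      by_contra hcon
      push Not at hcon
      obtain ⟨a, ha1, ha2⟩ := exists_between hcon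
      have h1 : (a : EReal) < Q.J ub := by
        rw [hQ.J_eq hub]; exact EReal.coe_lt_coe_iff.2 ha2
      have h2 := hwt.eventually (hQ.J_lsc ub a h1)
      have h3 := hR.eventually (gt_mem_nhds ha1)
      obtain ⟨k, hk2, hk3⟩ := (h2.and h3).exists
      rw [hQ.J_eq (hwU k), gt_iff_lt, EReal.coe_lt_coe_iff] at hk2
      have := hJle k
      linarith
    unfold Lreal at hmain ⊢
    linarith

/-! ### Step sizes and determinacy of a run. -/

section Run

variable {p₀ : Dual m} {u₀ : Prim d} {ε₀ : ℝ} {idx : ℕ → Fin N}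
  {u : ℕ → Prim d} {p : ℕ → Dual m} {ε : ℕ → ℝ}

theorem IsRun.mem (h : Q.IsRun K BG τ β γ ρ μ T u₀ p₀ ε₀ idx u p ε) (hu₀ : u₀ ∈ Q.U) (k : ℕ) :
    u k ∈ Q.U := by
  cases k with
  | zero => rw [h.u_zero]; exact hu₀
  | succ k => exact h.u_mem k

theorem le_stepCap (hβ : 0 < β) (hpos : 0 < BG + γ * τ ^ 2) {q : Dual m} {R : ℝ} (hq : ‖q‖ ≤ R) :
    β / (2 * (BG + R * ‖T‖ + γ * τ ^ 2)) ≤ stepCap BG τ β γ T q := by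
  have h1 : 0 ≤ ‖q‖ * ‖T‖ := by positivity
  have h2 : ‖q‖ * ‖T‖ ≤ R * ‖T‖ := by gcongr
  unfold stepCap
  apply div_le_div_of_nonneg_left hβ.le <;> linarith

theorem stepCap_pos (hβ : 0 < β) (hpos : 0 < BG + γ * τ ^ 2) (q : Dual m) :
    0 < stepCap BG τ β γ T q := by
  have h1 : 0 ≤ ‖q‖ * ‖T‖ := by positivity
  refine lt_of_lt_of_le (div_pos hβ ?_) (le_stepCap hβ hpos le_rfl)
  linarith

theorem IsRun.eps_lower (h : Q.IsRun K BG τ β γ ρ μ T u₀ p₀ ε₀ idx u p ε) {c : ℝ} (hc : c ≤ ε₀)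
    (hcap : ∀ k, c ≤ stepCap BG τ β γ T (Q.q γ (u k) (p k))) (k : ℕ) : c ≤ ε k := by
  induction k with
  | zero => rw [h.eps_zero]; exact le_min hc (hcap 0)
  | succ k ih => rw [h.eps_succ]; exact le_min ih (hcap (k + 1))

theorem IsRun.eps_pos (h : Q.IsRun K BG τ β γ ρ μ T u₀ p₀ ε₀ idx u p ε) (hβ : 0 < β)
    (hpos : 0 < BG + γ * τ ^ 2) (hε₀ : 0 < ε₀) (k : ℕ) : 0 < ε k := by
  induction k with
  | zero => rw [h.eps_zero]; exact lt_min hε₀ (stepCap_pos hβ hpos _)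
  | succ k ih => rw [h.eps_succ]; exact lt_min ih (stepCap_pos hβ hpos _)

theorem IsRun.eps_le_cap (h : Q.IsRun K BG τ β γ ρ μ T u₀ p₀ ε₀ idx u p ε) (k : ℕ) :
    ε k ≤ stepCap BG τ β γ T (Q.q γ (u k) (p k)) := by
  cases k with
  | zero => rw [h.eps_zero]; exact min_le_right _ _
  | succ k => rw [h.eps_succ]; exact min_le_right _ _

theorem IsRun.norm_p_succ_le (h : Q.IsRun K BG τ β γ ρ μ T u₀ p₀ ε₀ idx u p ε) (hμ : 0 ≤ μ)
    (k : ℕ) : ‖p (k + 1)‖ ≤ μ := by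
  rw [h.p_succ]; exact (ball_projection_spec hμ _).1

/-- If the primal iterates are bounded, the step sizes stay away from zero. -/
theorem IsRun.exists_eps_lower (h : Q.IsRun K BG τ β γ ρ μ T u₀ p₀ ε₀ idx u p ε)
    (hQ : Q.Standing BG T τ) (hu₀ : u₀ ∈ Q.U) (hβ : 0 < β) (hγ : 0 < γ)
    (hpos : 0 < BG + γ * τ ^ 2) (hε₀ : 0 < ε₀) (hμ : 0 ≤ μ) {R : ℝ} (hR : ∀ k, ‖u k‖ ≤ R) :
    ∃ e > 0, ∀ k, e ≤ ε k := by
  -- The term `‖p₀‖` is there because the initial multiplier need not lie in the ball.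
  set M := ‖p₀‖ + μ + γ * (‖Q.Theta u₀‖ + τ * (R + ‖u₀‖)) with hM
  have hq : ∀ k, ‖Q.q γ (u k) (p k)‖ ≤ M := fun k => by
    have h1 := norm_sub_nearestPoint_le Q.Cstar.isClosed Q.Cstar.convex ⟨0, Q.Cstar.zero_mem⟩
      (p k + γ • Q.Theta (u k)) Q.Cstar.zero_mem
    rw [zero_sub, zero_sub, norm_neg, norm_neg] at h1
    have h2 : ‖p k‖ ≤ ‖p₀‖ + μ := by
      cases k with
      | zero => rw [h.p_zero]; linarith
      | succ k => linarith [h.norm_p_succ_le hμ k, norm_nonneg p₀]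
    have h3 := hQ.Theta_lip_on (h.mem hu₀ k) hu₀
    have h4 : ‖u k - u₀‖ ≤ R + ‖u₀‖ := (norm_sub_le _ _).trans (by linarith [hR k])
    have h5 : ‖Q.Theta (u k)‖ ≤ ‖Q.Theta u₀‖ + τ * (R + ‖u₀‖) := by
      have := norm_le_norm_add_norm_sub' (Q.Theta (u k)) (Q.Theta u₀)
      have := mul_le_mul_of_nonneg_left h4 hQ.tau_nonneg
      linarith
    refine h1.trans ((norm_add_le _ _).trans ?_)
    rw [norm_smul, Real.norm_of_nonneg hγ.le]
    have := mul_le_mul_of_nonneg_left h5 hγ.le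
    linarith
  have hM0 : 0 ≤ M := (norm_nonneg _).trans (hq 0)
  have h6 : 0 ≤ M * ‖T‖ := by positivity
  refine ⟨min ε₀ (β / (2 * (BG + M * ‖T‖ + γ * τ ^ 2))), lt_min hε₀ (div_pos hβ (by linarith)),
    h.eps_lower (min_le_left _ _) fun k =>
      (min_le_right _ _).trans (le_stepCap hβ hpos (hq k))⟩

/-- The iterates are determined by the block choices made so far. -/
theorem IsRun.determined (h : Q.IsRun K BG τ β γ ρ μ T u₀ p₀ ε₀ idx u p ε)
    {idx' : ℕ → Fin N} {u' : ℕ → Prim d} {p' : ℕ → Dual m} {ε' : ℕ → ℝ}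
    (h' : Q.IsRun K BG τ β γ ρ μ T u₀ p₀ ε₀ idx' u' p' ε')
    (hQ : Q.Standing BG T τ) (hK : IsCore Q.U K β B) (hpos : 0 < BG + γ * τ ^ 2) (hε₀ : 0 < ε₀)
    {k : ℕ} (hidx : ∀ j < k, idx j = idx' j) : u k = u' k ∧ p k = p' k ∧ ε k = ε' k := by
  induction k with
  | zero =>
    have hu : u 0 = u' 0 := by rw [h.u_zero, h'.u_zero]
    have hp : p 0 = p' 0 := by rw [h.p_zero, h'.p_zero]
    exact ⟨hu, hp, by rw [h.eps_zero, h'.eps_zero, hu, hp]⟩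
  | succ k ih =>
    obtain ⟨hu, hp, hε⟩ := ih fun j hj => hidx j (by omega)
    have hmin' := h'.u_min k
    rw [← hidx k (by omega), ← hu, ← hp, ← hε] at hmin'
    have hu1 : u (k + 1) = u' (k + 1) :=
      hQ.primal_unique hK (Q.q_mem _ _ _) (h.eps_pos hK.beta_pos hpos hε₀ k) (h.u_mem k)
        (h'.u_mem k) (h.u_min k) hmin'
    have hp1 : p (k + 1) = p' (k + 1) := by rw [h.p_succ, h'.p_succ, hp, hu1]
    exact ⟨hu1, hp1, by rw [h.eps_succ, h'.eps_succ, hu1, hp1, hε]⟩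

end Run

/-- The dual part of a saddle point solves the dual problem. -/
theorem IsSaddle.isDualOptimal {us : Prim d} {ps : Dual m} (hs : Q.IsSaddle us ps) :
    Q.IsDualOptimal ps := by
  obtain ⟨hus, hps, h⟩ := hs
  refine ⟨hps, fun p hp => ?_⟩
  unfold dualFun
  rw [if_pos hp, if_pos hps]
  exact (iInf₂_le us hus).trans (le_iInf₂ fun v hv => (h v hv p hp).1.trans (h v hv p hp).2)

end Problem

end SPDCL

end

/-! ### The almost sure convergence theorem. -/

theorem theorem3 {N m : ℕ} {d : Fin N → ℕ} (Q : SPDCL.Problem d m)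
    (BG τ β B γ ρ μ₀ : ℝ) (T : SPDCL.Dual m)
    (hQ : Q.Standing BG T τ)
    (Kb : ∀ i, EuclideanSpace ℝ (Fin (d i)) → ℝ)
    (hK : SPDCL.IsCore Q.U (SPDCL.coreSum Kb) β B)
    (hγ : 0 < γ) (hρ : ρ = γ / (2 * (N : ℝ) - 1))
    (hpos : 0 < BG + γ * τ ^ 2)
    (hμ₀ : ∀ p, Q.IsDualOptimal p → ‖p‖ ≤ μ₀)
    (u₀ : SPDCL.Prim d) (hu₀ : u₀ ∈ Q.U) (p₀ : SPDCL.Dual m) (ε₀ : ℝ) (hε₀ : 0 < ε₀)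
    {S : Type*} [MeasurableSpace S] (P : Measure S) [IsProbabilityMeasure P]
    (idx : ℕ → S → Fin N) (hmeas : ∀ k, Measurable (idx k))
    (hindep : iIndepFun idx P)
    (hunif : ∀ k i, P {ω | idx k ω = i} = (N : ENNReal)⁻¹)
    (u : ℕ → S → SPDCL.Prim d) (p : ℕ → S → SPDCL.Dual m) (ε : ℕ → S → ℝ)
    (hrun : ∀ ω, Q.IsRun (SPDCL.coreSum Kb) BG τ β γ ρ (μ₀ + 1) T u₀ p₀ ε₀
      (fun k => idx k ω) (fun k => u k ω) (fun k => p k ω) (fun k => ε k ω)) :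
    ((∀ k, Integrable (fun ω => β / 4 * ‖u k ω - u (k + 1) ω‖ ^ 2) P) ∧
      (∀ᵐ ω ∂P, Summable (fun k =>
        condExp (SPDCL.past idx k) P (fun ω' => β / 4 * ‖u k ω' - u (k + 1) ω'‖ ^ 2) ω)) ∧
      (∀ᵐ ω ∂P, Summable (fun k =>
        ε k ω / (2 * N * γ) * ‖Q.q γ (u k ω) (p k ω) - p k ω‖ ^ 2))) ∧
    (∀ᵐ ω ∂P, ∃ R : ℝ, ∀ k, ‖u k ω‖ ≤ R) ∧
    (∀ᵐ ω ∂P, ∀ (ub : SPDCL.Prim d) (pb : SPDCL.Dual m),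
      MapClusterPt (ub, pb) Filter.atTop (fun k => (u k ω, p k ω)) → Q.IsSaddle ub pb) := by
  classical
  obtain ⟨us, ps, hs⟩ := hQ.exists_saddle
  have hpsμ₀ := hμ₀ ps hs.isDualOptimal
  have hμ : 0 ≤ μ₀ + 1 := by linarith [norm_nonneg ps]
  have hpsμ : ‖ps‖ ≤ μ₀ + 1 := by linarith
  have hβ := hK.beta_pos
  have hN : 1 ≤ N := by
    obtain ⟨ω⟩ : Nonempty S := nonempty_of_isProbabilityMeasure P
    have := (idx 0 ω).2
    omega
  have hN0 : (0:ℝ) < N := by exact_mod_cast hN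
  have hεpos : ∀ k ω, 0 < ε k ω := fun k ω => (hrun ω).eps_pos hβ hpos hε₀ k
  have hmem : ∀ k ω, u k ω ∈ Q.U := fun k ω => (hrun ω).mem hu₀ k
  have hdet : ∀ k ω ω', (∀ j < k, idx j ω = idx j ω') →
      u k ω = u k ω' ∧ p k ω = p k ω' ∧ ε k ω = ε k ω' := fun k ω ω' h =>
    (hrun ω).determined (hrun ω') hQ hK hpos hε₀ h
  have hbr : ∀ k i ω, ∃ ω', (∀ j < k, idx j ω' = idx j ω) ∧ idx k ω' = i := fun k i ω =>
    SPDCL.exists_branch hindep hunif k i ω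
  -- `u (k + 1) (br k i ω)` is the update that block `i` would produce after the history of `ω`.
  choose br hbr using hbr
  have hmin : ∀ k i ω, IsMinOn (Q.primalObj (SPDCL.coreSum Kb) i (ε k ω) (u k ω)
      (Q.q γ (u k ω) (p k ω))) Q.U (u (k + 1) (br k i ω)) := fun k i ω => by
    have h := (hrun (br k i ω)).u_min k
    obtain ⟨h1, h2, h3⟩ := hdet k _ _ (hbr k i ω).1
    simp only [h1, h2, h3, (hbr k i ω).2] at h
    exact h
  have hstepdep : ∀ k, SPDCL.DependsOnPast idx (k + 1)
      (fun ω => β / 4 * ‖u k ω - u (k + 1) ω‖ ^ 2) := fun k ω ω' h => by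
    simp only [(hdet k ω ω' fun j hj => h j (by omega)).1, (hdet (k + 1) ω ω' h).1]
  set M : ℕ → S → ℝ := fun k ω =>
    (N : ℝ)⁻¹ * ∑ i, β / 4 * ‖u k ω - u (k + 1) (br k i ω)‖ ^ 2 with hM
  set c : ℕ → S → ℝ := fun k ω =>
    ε k ω / (2 * N * γ) * ‖Q.q γ (u k ω) (p k ω) - p k ω‖ ^ 2 with hc
  set V : ℕ → S → ℝ := fun k ω =>
    Q.lyap (SPDCL.coreSum Kb) γ us ps (ε k ω) (u k ω) (p k ω) with hV
  have hM0 : ∀ k ω, 0 ≤ M k ω := fun k ω => by positivity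
  have hc0 : ∀ k ω, 0 ≤ c k ω := fun k ω => by have := hεpos k ω; positivity
  have hVlower : ∀ k ω, β / 2 * ‖us - u k ω‖ ^ 2 ≤ V k ω := fun k ω =>
    SPDCL.Problem.le_lyap hN hγ hQ hK hs (hmem k ω) (p k ω) (hεpos k ω).le
  have hVdep : ∀ k, SPDCL.DependsOnPast idx k (V k) := fun k ω ω' h => by
    obtain ⟨h1, h2, h3⟩ := hdet k ω ω' h
    simp only [hV, h1, h2, h3]
  have hcdep : ∀ k, SPDCL.DependsOnPast idx k (c k) := fun k ω ω' h => by
    obtain ⟨h1, h2, h3⟩ := hdet k ω ω' h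
    simp only [hc, h1, h2, h3]
  have hMdep : ∀ k, SPDCL.DependsOnPast idx k (M k) := fun k ω ω' h => by
    have h2 : ∀ i, u (k + 1) (br k i ω) = u (k + 1) (br k i ω') := fun i =>
      SPDCL.DependsOnPast.comp_branch (f := u (k + 1)) (fun a b hab => (hdet _ a b hab).1)
        (hbr k i) ω ω' h
    simp only [hM, (hdet k ω ω' h).1, h2]
  have hMcond : ∀ k, condExp (SPDCL.past idx k) P
      (fun ω => β / 4 * ‖u k ω - u (k + 1) ω‖ ^ 2) =ᵐ[P] M k := fun k => by
    filter_upwards [SPDCL.condExp_past_eq hmeas hindep hunif (hstepdep k) (hbr k)] with ω hω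
    rw [hω]
    simp only [hM, fun i => (hdet k _ _ (hbr k i ω).1).1]
  -- The decrease starts at index `1`: `p 0` may lie outside the ball, where `dual_step` does not
  -- apply.
  have hdec : ∀ k, condExp (SPDCL.past idx (k + 1)) P (V (k + 1 + 1)) ≤ᵐ[P]
      fun ω => V (k + 1) ω - (M (k + 1) ω + c (k + 1) ω) := fun k => by
    filter_upwards [SPDCL.condExp_past_eq hmeas hindep hunif (hVdep (k + 1 + 1)) (hbr (k + 1))]
      with ω hω
    rw [hω]
    have h := SPDCL.Problem.sum_lyap_step hN hQ hK hγ hρ hpos hs hpsμ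
      ((hrun ω).norm_p_succ_le hμ k) (hmem (k + 1) ω)
      (x := fun i => u (k + 1 + 1) (br (k + 1) i ω)) (fun i => hmem _ _) (hεpos (k + 1) ω)
      ((hrun ω).eps_le_cap (k + 1)) (fun i => hmin (k + 1) i ω)
      (p' := fun i => p (k + 1 + 1) (br (k + 1) i ω))
      (fun i => by
        have h := (hrun (br (k + 1) i ω)).p_succ (k + 1)
        rwa [(hdet (k + 1) _ _ (hbr (k + 1) i ω).1).2.1] at h)
      (ε' := fun i => ε (k + 1 + 1) (br (k + 1) i ω))
      (fun i => by
        have h := (hrun (br (k + 1) i ω)).eps_succ (k + 1)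
        rw [(hdet (k + 1) _ _ (hbr (k + 1) i ω).1).2.2] at h
        exact h.le.trans (min_le_left _ _))
    simp only [hV, hM, hc]
    linarith
  have hae := SPDCL.ae_bounded_and_summable hmeas (V := fun k => V (k + 1))
    (A := fun k ω => M (k + 1) ω + c (k + 1) ω) (fun k => hVdep (k + 1))
    (fun k ω ω' h => congrArg₂ (· + ·) (hMdep (k + 1) ω ω' h) (hcdep (k + 1) ω ω' h))
    (fun k ω => le_trans (by positivity) (hVlower (k + 1) ω))
    (fun k ω => add_nonneg (hM0 _ _) (hc0 _ _)) hdec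
  have hMsum : ∀ᵐ ω ∂P, Summable fun k => M k ω := by
    filter_upwards [hae] with ω hω
    rw [← summable_nat_add_iff 1]
    exact hω.2.of_nonneg_of_le (fun k => hM0 _ _) fun k => le_add_of_nonneg_right (hc0 _ _)
  have hcsum : ∀ᵐ ω ∂P, Summable fun k => c k ω := by
    filter_upwards [hae] with ω hω
    rw [← summable_nat_add_iff 1]
    exact hω.2.of_nonneg_of_le (fun k => hc0 _ _) fun k => le_add_of_nonneg_left (hM0 _ _)
  have hbound : ∀ᵐ ω ∂P, ∃ R : ℝ, ∀ k, ‖u k ω‖ ≤ R := by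
    filter_upwards [hae] with ω hω
    obtain ⟨R, hR⟩ := hω.1
    refine ⟨‖us‖ + √(2 / β * R) + ‖u 0 ω‖, fun k => ?_⟩
    cases k with
    | zero => linarith [norm_nonneg us, Real.sqrt_nonneg (2 / β * R)]
    | succ k =>
      have h1 := (hVlower (k + 1) ω).trans (hR k)
      have h2 : ‖us - u (k + 1) ω‖ ≤ √(2 / β * R) := by
        refine Real.le_sqrt_of_sq_le ?_
        have := mul_le_mul_of_nonneg_left h1 (show 0 ≤ 2 / β by positivity)
        rwa [← mul_assoc, div_mul_div_cancel₀ hβ.ne', div_self two_ne_zero, one_mul] at this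
      have h3 := norm_le_norm_add_norm_sub us (u (k + 1) ω)
      linarith [norm_nonneg (u 0 ω)]
  refine ⟨⟨fun k => (hstepdep k).integrable hmeas, ?_, hcsum⟩, hbound, ?_⟩
  · filter_upwards [hMsum, ae_all_iff.2 hMcond] with ω h1 h2
    simpa only [h2] using h1
  · filter_upwards [hMsum, hcsum, hbound] with ω hMs hcs hR ub pb hcl
    obtain ⟨R, hR⟩ := hR
    obtain ⟨e, he, heε⟩ := (hrun ω).exists_eps_lower hQ hu₀ hβ hγ hpos hε₀ hμ hR
    obtain ⟨φ, hφ, hlim⟩ := hcl.tendsto_subseq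
    have hut : Filter.Tendsto (fun k => u (φ k) ω) Filter.atTop (nhds ub) :=
      (continuous_fst.tendsto (ub, pb)).comp hlim
    have hpt : Filter.Tendsto (fun k => p (φ k) ω) Filter.atTop (nhds pb) :=
      (continuous_snd.tendsto (ub, pb)).comp hlim
    -- `M` averages over every block, so the candidates that were not selected also approach `u k`.
    have hstep : ∀ i, Filter.Tendsto (fun k => u k ω - u (k + 1) (br k i ω)) Filter.atTop
        (nhds 0) := fun i => by
      rw [tendsto_zero_iff_norm_tendsto_zero]
      have h1 : Filter.Tendsto (fun k => 4 * N / β * M k ω) Filter.atTop (nhds 0) := by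
        simpa using hMs.tendsto_atTop_zero.const_mul (4 * N / β)
      have h2 : Filter.Tendsto (fun k => ‖u k ω - u (k + 1) (br k i ω)‖ ^ 2) Filter.atTop
          (nhds 0) := by
        refine squeeze_zero (fun k => by positivity) (fun k => ?_) h1
        have h3 : 4 * N / β * M k ω = ∑ i, ‖u k ω - u (k + 1) (br k i ω)‖ ^ 2 := by
          simp only [hM]
          rw [← Finset.mul_sum]
          field_simp
        rw [h3]
        exact Finset.single_le_sum (f := fun i => ‖u k ω - u (k + 1) (br k i ω)‖ ^ 2)
          (fun _ _ => by positivity) (Finset.mem_univ i)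
      simpa using h2.sqrt
    have hres : Filter.Tendsto (fun k => Q.q γ (u k ω) (p k ω) - p k ω) Filter.atTop
        (nhds 0) := by
      rw [tendsto_zero_iff_norm_tendsto_zero]
      have h1 : Filter.Tendsto (fun k => 2 * N * γ / e * c k ω) Filter.atTop (nhds 0) := by
        simpa using hcs.tendsto_atTop_zero.const_mul (2 * N * γ / e)
      have h2 : Filter.Tendsto (fun k => ‖Q.q γ (u k ω) (p k ω) - p k ω‖ ^ 2) Filter.atTop
          (nhds 0) := by
        refine squeeze_zero (fun k => by positivity) (fun k => ?_) h1
        have h3 : 2 * N * γ / e * c k ω =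
            ε k ω / e * ‖Q.q γ (u k ω) (p k ω) - p k ω‖ ^ 2 := by
          simp only [hc]
          field_simp
        rw [h3]
        exact le_mul_of_one_le_left (by positivity) ((one_le_div he).2 (heε k))
      simpa using h2.sqrt
    refine hQ.isSaddle_of_tendsto hK hγ (u := fun k => u (φ k) ω) (p := fun k => p (φ k) ω)
      (ε := fun k => ε (φ k) ω) (x := fun k i => u (φ k + 1) (br (φ k) i ω)) he
      (fun k => heε _) (fun k => hmem _ _) (fun k i => hmem _ _) (fun k i => hmin (φ k) i ω)
      hut hpt (fun i => ?_) ?_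
    · simpa using hut.sub ((hstep i).comp hφ.tendsto_atTop)
    · simpa using (hres.comp hφ.tendsto_atTop).add hpt
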